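/- For a set $V\subseteq\mathbb R^2$ and $s\ge 0$ let $G(V,s)$ be the graph with vertex set $V$ in which two distinct points $v,w$ are adjacent iff $\|v-w\|\le s$ (Euclidean norm). Let $0<\eta<1/\sqrt2$, $r>0$, and let $V\subseteq[0,1]^2$ be finite. Put $r':=r(1-\eta\sqrt2)$ and let $P$ be the set of points of $[0,1]^2$ whose coordinates are integer multiples of $\eta r$. Call $p\in P$ dense if the square $p+[0,\eta r)^2$ contains at least $100$ points of $V$, and bad if no $q\in P$ with $\|q-p\|\le r'$ (including $q=p$) is dense. Let $\mathcal D$ and $\mathcal B$ be the subgraphs of $G(P,r')$ induced by the dense points and by the bad points. "Component" means connected component, and $\operatorname{diam}$ is the Euclidean diameter of the vertex set. Suppose that: (P1) every component $\mathcal C$ of $\mathcal D$ has $\operatorname{diam}(\mathcal C)<r'$ or $\operatorname{diam}(\mathcal C)>1000r$; (P2) if $\mathcal C_1\ne\mathcal C_2$ are components of $\mathcal D$ of diameter $<r'$ and $p_1\in\mathcal C_1$, $p_2\in\mathcal C_2$, then $\|p_1-p_2\|>1000r$; (P3) if $p_1$ lies in a component of $\mathcal D$ of diameter $<r'$ and $p_2$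 is bad, then $\|p_1-p_2\|>1000r$; (P4) if $p,q$ are bad, then $\|p-q\|<r'$ or $\|p-q\|>1000r$; (P5) if $p_1,p_2$ are dense, $\|p_1-p_2\|<25r$, and neither lies in a component of $\mathcal D$ of diameter $<r'$, then there is a $p_1p_2$-path in $\mathcal D$ all of whose vertices lie in the disk $B(p_1,100r)=\{x:\|x-p_1\|\le100r\}$; (P6) exactly one component of $\mathcal D$ has diameter $\ge r'$. If $r\le\rho\le2r$ and $G(V,\rho)$ is 2-connected (it has more than two vertices, and removing any set of fewer than two vertices leaves a connected graph), then $G(V,\rho)$ is Hamiltonian, i.e. it has a cycle through all its vertices. -/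

import Mathlib

namespace RGG

/-- The Euclidean plane. -/
abbrev Plane : Type := EuclideanSpace ℝ (Fin 2)

/-- The unit square `[0,1]²`. -/
def unitSquare : Set Plane := {v | ∀ i, 0 ≤ v i ∧ v i ≤ 1}

/-- The geometric graph `G(V, r)`: its vertices are the points of `V`, and two distinct points are
adjacent iff their Euclidean distance is at most `r`. -/
def geomGraph (V : Set Plane) (r : ℝ) : SimpleGraph V where
  Adj v w := v ≠ w ∧ dist (v : Plane) (w : Plane) ≤ r
  symm := ⟨fun v w h => ⟨h.1.symm, by rw [dist_comm]; exact h.2⟩⟩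
  loopless := ⟨fun _ h => h.1 rfl⟩

/-- `G` is `k`-connected: it has more than `k` vertices, and removing any set of fewer than `k`
vertices leaves a connected graph. -/
def IsKConnected {α : Type*} (G : SimpleGraph α) (k : ℕ) : Prop :=
  (k : ℕ∞) < ENat.card α ∧ ∀ S : Set α, S.encard < (k : ℕ∞) → (G.induce Sᶜ).Connected

/-- The threshold distance `r' = r (1 - η √2)`. -/
noncomputable def rPrime (η r : ℝ) : ℝ := r * (1 - η * Real.sqrt 2)

/-- The points of `[0,1]²` whose coordinates are integer multiples of `η r`. -/
def gridPoints (η r : ℝ) : Set Plane :=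
  {p | p ∈ unitSquare ∧ ∀ i, ∃ k : ℤ, p i = (k : ℝ) * (η * r)}

/-- The half-open square `p + [0, η r)²`. -/
def cell (η r : ℝ) (p : Plane) : Set Plane := {v | ∀ i, p i ≤ v i ∧ v i < p i + η * r}

/-- The grid points that are dense with respect to `V`: the square `p + [0, η r)²` contains at
least `100` points of `V`. -/
def densePoints (η : ℝ) (V : Set Plane) (r : ℝ) : Set Plane :=
  {p | p ∈ gridPoints η r ∧ 100 ≤ (V ∩ cell η r p).encard}

/-- The bad grid points: every grid point within distance `r'` (the point itself included) fails
to be dense. -/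
def badPoints (η : ℝ) (V : Set Plane) (r : ℝ) : Set Plane :=
  {p | p ∈ gridPoints η r ∧
    ∀ q ∈ gridPoints η r, dist q p ≤ rPrime η r → q ∉ densePoints η V r}

/-- The dense-square graph: the subgraph of `G(gridPoints η r, r')` induced by the dense points.
An induced subgraph of a geometric graph is the geometric graph of the smaller vertex set. -/
noncomputable def denseGraph (η : ℝ) (V : Set Plane) (r : ℝ) :
    SimpleGraph (densePoints η V r) :=
  geomGraph (densePoints η V r) (rPrime η r)

/-- The geometric diameter of a component of the dense-square graph, that is, the diameter of its
vertex set as a (finite) subset of the plane. -/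
noncomputable def compDiam {η : ℝ} {V : Set Plane} {r : ℝ}
    (C : (denseGraph η V r).ConnectedComponent) : ℝ :=
  Metric.diam ((fun p : densePoints η V r => (p : Plane)) '' C.supp)

/-- (P1) Every component of the dense-square graph has diameter `< r'` or `> 1000 r`. -/
def P1 (η : ℝ) (V : Set Plane) (r : ℝ) : Prop :=
  ∀ C : (denseGraph η V r).ConnectedComponent, compDiam C < rPrime η r ∨ 1000 * r < compDiam C

/-- (P2) Points of two distinct components of diameter `< r'` are at distance `> 1000 r`. -/
def P2 (η : ℝ) (V : Set Plane) (r : ℝ) : Prop :=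
  ∀ C₁ C₂ : (denseGraph η V r).ConnectedComponent, C₁ ≠ C₂ →
    compDiam C₁ < rPrime η r → compDiam C₂ < rPrime η r →
    ∀ p₁ ∈ C₁.supp, ∀ p₂ ∈ C₂.supp, 1000 * r < dist (p₁ : Plane) (p₂ : Plane)

/-- (P3) A point of a component of diameter `< r'` and a bad point are at distance `> 1000 r`. -/
def P3 (η : ℝ) (V : Set Plane) (r : ℝ) : Prop :=
  ∀ C : (denseGraph η V r).ConnectedComponent, compDiam C < rPrime η r →
    ∀ p₁ ∈ C.supp, ∀ p₂ ∈ badPoints η V r, 1000 * r < dist (p₁ : Plane) p₂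

/-- (P4) Two bad points are at distance `< r'` or `> 1000 r`. -/
def P4 (η : ℝ) (V : Set Plane) (r : ℝ) : Prop :=
  ∀ p ∈ badPoints η V r, ∀ q ∈ badPoints η V r, dist p q < rPrime η r ∨ 1000 * r < dist p q

/-- (P5) Two dense points at distance `< 25 r`, neither of which lies in a component of diameter
`< r'`, are joined by a path of the dense-square graph that stays inside the disk of radius
`100 r` around the first one. -/
def P5 (η : ℝ) (V : Set Plane) (r : ℝ) : Prop :=
  ∀ p₁ p₂ : densePoints η V r, dist (p₁ : Plane) (p₂ : Plane) < 25 * r →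
    ¬ compDiam ((denseGraph η V r).connectedComponentMk p₁) < rPrime η r →
    ¬ compDiam ((denseGraph η V r).connectedComponentMk p₂) < rPrime η r →
    ∃ w : (denseGraph η V r).Walk p₁ p₂, w.IsPath ∧
      ∀ x ∈ w.support, (x : Plane) ∈ Metric.closedBall (p₁ : Plane) (100 * r)

/-- (P6) Exactly one component of the dense-square graph has diameter `≥ r'`. -/
def P6 (η : ℝ) (V : Set Plane) (r : ℝ) : Prop :=
  ∃! C : (denseGraph η V r).ConnectedComponent, rPrime η r ≤ compDiam C

end RGG

/-! The Hamilton cycle is built as a permutation `σ` of the vertices with one orbit and `dist v (σ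
v) ≤ ρ` everywhere. Orbits of size 1 and 2 are harmless on the way. If `x` and `y` lie in different
orbits, `x` is close to `σ y` and `y` to `σ x`, then `σ * swap x y` joins the two orbits and changes
only the images of `x` and `y` (`sameCycle_mul_swap`). Merges at disjoint pairs do not disturb each
other (`exists_merges_pairs`), so a starting permutation and enough reserved vertices in each dense
cell suffice.

Vertices of cells whose corners are within `r'` are close to each other. Hence the dense cells of a
component merge into one orbit (`exists_merges_cells`), and vertices near a dense cell can be
absorbed. The difficulty is the obstructions, made of vertices not near the giant component. By
(P2)-(P4) the points of small components and the bad points form clusters of diameter below `r'`,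
more than `1000 r` apart. 2-connectivity gives each obstruction two exit edges; their outer ends are
near the giant, since no other obstruction is in reach, and (P5) joins them by a local path of giant
cells. This yields a cycle, the ear (`exists_ear`). An ear swallows an obstruction of bad cells,
which is a clique; in the other case it passes through dense cells of a small component, which can
then be merged with it. By (P6) all ears meet the same giant component. Ears are local, so each
dense cell meets at most one, in at most 7 vertices, and the other 93 leave room for the 79 reserved
ones. -/

namespace RGG

open Equiv Function

/-! ### Permutations: merging and gluing orbits. -/

section Perm

variable {V : Type*}

/-- If every element is related to its image, a permutation with one orbit on at least three
vertices gives a Hamilton cycle. -/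
theorem isHamiltonian_of_sameCycle [Fintype V] [DecidableEq V] (G : SimpleGraph V) (σ : Perm V)
    (hcard : 3 ≤ Fintype.card V) (hσ : ∀ x y, σ.SameCycle x y)
    (hG : ∀ v, v ≠ σ v → G.Adj v (σ v)) : G.IsHamiltonian := by
  intro _
  have hon : σ.IsCycleOn ((Finset.univ : Finset V) : Set V) :=
    ⟨by simp, fun x _ y _ => hσ x y⟩
  have hne : (Finset.univ : Finset V).Nontrivial := by
    rw [← Finset.one_lt_card_iff_nontrivial, Finset.card_univ]; omega
  -- `hG` says nothing at fixed points, but a single orbit on at least two elements has none.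
  have hadj : ∀ v, G.Adj v (σ v) := fun v =>
    hG v (hon.apply_ne (by exact_mod_cast hne) (by simp)).symm
  obtain ⟨a, -⟩ := hne.nonempty
  obtain ⟨n, hn⟩ : ∃ n, Fintype.card V = n + 3 := ⟨Fintype.card V - 3, by omega⟩
  have hpow : ∀ i j : ℕ, (σ ^ i) a = (σ ^ j) a ↔ i ≡ j [MOD n + 3] := by
    intro i j
    rw [hon.pow_apply_eq_pow_apply (Finset.mem_univ a), Finset.card_univ, hn]
  have hstep : ∀ u v : Fin (n + 3), (u - v).val = 1 → G.Adj ((σ ^ v.val) a) ((σ ^ u.val) a) := by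
    intro u v huv
    have : (σ ^ u.val) a = (σ ^ (v.val + 1)) a := by
      rw [hpow]
      have h1 : u = (u - v) + v := by simp
      have h2 := congrArg Fin.val h1
      rw [Fin.val_add, huv] at h2
      rw [h2, add_comm v.val]
      exact Nat.mod_modEq _ _
    rw [this, pow_succ']
    exact hadj _
  have hcont : (SimpleGraph.cycleGraph (n + 3)).IsContained G := by
    refine ⟨⟨⟨fun i => (σ ^ i.val) a, ?_⟩, ?_⟩⟩
    · intro u v huv
      rcases SimpleGraph.cycleGraph_adj'.1 huv with h | h
      · exact (hstep _ _ h).symm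
      · exact hstep _ _ h
    · intro i j hij
      have := (hpow i j).1 hij
      exact Fin.ext (Nat.ModEq.eq_of_lt_of_lt this i.2 j.2)
  obtain ⟨v, p, hp, hl⟩ := (SimpleGraph.cycleGraph_isContained_iff (by omega)).1 hcont
  exact ⟨v, p, SimpleGraph.Walk.isHamiltonianCycle_iff_isCycle_and_length_eq.2 ⟨hp, by omega⟩⟩

theorem sameCycle_of_forall_apply {f g : Perm V} [Finite V]
    (h : ∀ a, g.SameCycle a (f a)) {x y : V} (hxy : f.SameCycle x y) : g.SameCycle x y := by
  obtain ⟨n, rfl⟩ := hxy.exists_nat_pow_eq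
  induction n with
  | zero => exact Perm.SameCycle.refl _ _
  | succ n ih =>
    rw [pow_succ']
    exact (ih ⟨n, by simp⟩).trans (h _)

/-- Multiplying by a transposition of elements of different orbits merges the two orbits. -/
theorem sameCycle_mul_swap [Finite V] [DecidableEq V] {f : Perm V} {x y : V}
    (hxy : ¬ f.SameCycle x y) :
    (f * swap x y).SameCycle x y ∧
      ∀ a b, f.SameCycle a b → (f * swap x y).SameCycle a b := by
  set g := f * swap x y with hg
  have hgx : g x = f y := by simp [hg]
  have hgy : g y = f x := by simp [hg]
  have hgo : ∀ a, a ≠ x → a ≠ y → g a = f a := fun a h1 h2 => by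
    simp [hg, swap_apply_of_ne_of_ne h1 h2]
  -- From `x` the map `g` jumps to `f y` and then follows `f` along the orbit of `y`, which avoids
  -- `x`, until it arrives at `y`.
  have hx : g.SameCycle x y := by
    by_contra hcon
    have hall : ∀ n : ℕ, g.SameCycle x ((f ^ (n + 1)) y) := by
      intro n
      induction n with
      | zero => simpa [← hgx] using (Perm.SameCycle.refl g x)
      | succ n ih =>
        have h1 : (f ^ (n + 1)) y ≠ x := fun h => hxy ⟨-((n + 1 : ℕ) : ℤ), by
          rw [← h, zpow_neg, zpow_natCast]; simp⟩
        have h2 : (f ^ (n + 1)) y ≠ y := fun h => hcon (h ▸ ih)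
        have : (f ^ (n + 1 + 1)) y = g ((f ^ (n + 1)) y) := by
          rw [hgo _ h1 h2, pow_succ' f (n + 1)]; rfl
        rw [this]
        exact Perm.sameCycle_apply_right.2 ih
    have hpos := orderOf_pos f
    have := hall (orderOf f - 1)
    rw [Nat.sub_add_cancel hpos, pow_orderOf_eq_one] at this
    exact hcon this
  refine ⟨hx, fun a b hab => sameCycle_of_forall_apply (fun a => ?_) hab⟩
  by_cases h1 : a = x
  · rw [h1, ← hgy]; exact Perm.sameCycle_apply_right.2 hx
  by_cases h2 : a = y
  · rw [h2, ← hgx]; exact Perm.sameCycle_apply_right.2 hx.symm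
  rw [← hgo a h1 h2]
  exact Perm.sameCycle_apply_right.2 (Perm.SameCycle.refl g a)

/-- `σ'` is obtained from `σ` by merging orbits along the relation `R`, and the two permutations
agree outside `U`. -/
structure Merges (R : V → V → Prop) (U : Set V) (σ σ' : Perm V) : Prop where
  rel : ∀ v, R v (σ' v)
  coarser : ∀ x y, σ.SameCycle x y → σ'.SameCycle x y
  agree : ∀ v, v ∉ U → σ' v = σ v

theorem Merges.trans {R : V → V → Prop} {U₁ U₂ : Set V} {σ₁ σ₂ σ₃ : Perm V}
    (h₁ : Merges R U₁ σ₁ σ₂) (h₂ : Merges R U₂ σ₂ σ₃) : Merges R (U₁ ∪ U₂) σ₁ σ₃ where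
  rel := h₂.rel
  coarser x y h := h₂.coarser _ _ (h₁.coarser _ _ h)
  agree v hv := by
    rw [Set.mem_union, not_or] at hv
    rw [h₂.agree v hv.2, h₁.agree v hv.1]

theorem Merges.mono {R : V → V → Prop} {U₁ U₂ : Set V} {σ₁ σ₂ : Perm V}
    (h : Merges R U₁ σ₁ σ₂) (hU : U₁ ⊆ U₂) : Merges R U₂ σ₁ σ₂ :=
  ⟨h.rel, h.coarser, fun v hv => h.agree v fun h' => hv (hU h')⟩

/-- Orbits can be merged simultaneously along pairs of pairwise distinct elements. -/
theorem exists_merges_pairs [Finite V] {R : V → V → Prop} {σ : Perm V}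
    (hσ : ∀ v, R v (σ v)) {ι : Type*} [Finite ι] (x y : ι → V)
    (hinj : Injective (Sum.elim x y)) (hxy : ∀ i, R (x i) (σ (y i)))
    (hyx : ∀ i, R (y i) (σ (x i))) :
    ∃ σ', Merges R (Set.range x ∪ Set.range y) σ σ' ∧ ∀ i, σ'.SameCycle (x i) (y i) := by
  classical
  cases nonempty_fintype ι
  have key : ∀ s : Finset ι, ∃ σ', Merges R (x '' s ∪ y '' s) σ σ' ∧
      ∀ i ∈ s, σ'.SameCycle (x i) (y i) := by
    intro s
    induction s using Finset.induction_on with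
    | empty => exact ⟨σ, ⟨hσ, fun _ _ h => h, fun _ _ => rfl⟩, by simp⟩
    | insert i s his ih =>
      obtain ⟨τ, hτ, hs⟩ := ih
      have hx : x i ∉ x '' s ∪ y '' s := by
        rintro (⟨j, hj, h⟩ | ⟨j, hj, h⟩)
        · exact his ((Sum.inl_injective (@hinj (.inl j) (.inl i) h)) ▸ hj)
        · exact Sum.inr_ne_inl (@hinj (.inr j) (.inl i) h)
      have hy : y i ∉ x '' s ∪ y '' s := by
        rintro (⟨j, hj, h⟩ | ⟨j, hj, h⟩)
        · exact Sum.inl_ne_inr (@hinj (.inl j) (.inr i) h)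
        · exact his ((Sum.inr_injective (@hinj (.inr j) (.inr i) h)) ▸ hj)
      have hsub : x '' s ∪ y '' s ⊆
          x '' (insert i s : Finset ι) ∪ y '' (insert i s : Finset ι) := by
        gcongr <;> simp
      -- If earlier merges already joined the two, a swap would split their orbit, so nothing is
      -- done. Otherwise `τ` still agrees with `σ` at both elements, and `hxy`, `hyx` apply.
      by_cases hi : τ.SameCycle (x i) (y i)
      · refine ⟨τ, hτ.mono hsub, fun j hj => ?_⟩
        rcases Finset.mem_insert.1 hj with rfl | hj
        · exact hi
        · exact hs j hj
      · obtain ⟨h1, h2⟩ := sameCycle_mul_swap hi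
        refine ⟨τ * swap (x i) (y i), ⟨fun v => ?_, fun a b h => h2 _ _ (hτ.coarser _ _ h),
          fun v hv => ?_⟩, fun j hj => ?_⟩
        · by_cases hvx : v = x i
          · simpa [hvx, hτ.agree _ hy] using hxy i
          by_cases hvy : v = y i
          · simpa [hvy, hτ.agree _ hx] using hyx i
          simpa [swap_apply_of_ne_of_ne hvx hvy] using hτ.rel v
        · have hvx : v ≠ x i := fun h => hv (Or.inl ⟨i, by simp, h.symm⟩)
          have hvy : v ≠ y i := fun h => hv (Or.inr ⟨i, by simp, h.symm⟩)
          simpa [swap_apply_of_ne_of_ne hvx hvy] using hτ.agree v (fun h => hv (hsub h))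
        · rcases Finset.mem_insert.1 hj with rfl | hj
          · exact h1
          · exact h2 _ _ (hs j hj)
  obtain ⟨σ', h1, h2⟩ := key Finset.univ
  exact ⟨σ', by simpa using h1, fun i => h2 i (Finset.mem_univ i)⟩

/-- Permutations that are transitive on the fibres of a map glue to a single permutation. -/
theorem exists_perm_glue {L : Type*} (β : V → L) (τ : L → Perm V)
    (hτ : ∀ l, (τ l).IsCycleOn {v | β v = l}) :
    ∃ σ : Perm V, (∀ v, σ v = τ (β v) v) ∧ ∀ v w, β v = β w → σ.SameCycle v w := by
  have hβ : ∀ v, β (τ (β v) v) = β v := fun v => (hτ (β v)).apply_mem_iff.2 rfl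
  have hβ' : ∀ v, β ((τ (β v))⁻¹ v) = β v := fun v =>
    (hτ (β v)).inv.apply_mem_iff.2 rfl
  let σ : Perm V :=
    { toFun := fun v => τ (β v) v
      invFun := fun v => (τ (β v))⁻¹ v
      left_inv := fun v => by simp [hβ v]
      right_inv := fun v => by
        change τ (β ((τ (β v))⁻¹ v)) ((τ (β v))⁻¹ v) = v
        rw [hβ' v]; simp }
  refine ⟨σ, fun v => rfl, fun v w hvw => ?_⟩
  have hpow : ∀ n : ℕ, ((σ ^ n) v = (τ (β v) ^ n) v) ∧ β ((σ ^ n) v) = β v := by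
    intro n
    induction n with
    | zero => simp
    | succ n ih =>
      have h1 : (σ ^ (n + 1)) v = τ (β ((σ ^ n) v)) ((σ ^ n) v) := by rw [pow_succ']; rfl
      refine ⟨?_, ?_⟩
      · rw [h1, ih.2, ih.1, pow_succ']; rfl
      · rw [h1, hβ, ih.2]
  have hpow' : ∀ n : ℕ, ((σ ^ n)⁻¹ v = ((τ (β v)) ^ n)⁻¹ v) ∧ β ((σ ^ n)⁻¹ v) = β v := by
    intro n
    induction n with
    | zero => simp
    | succ n ih =>
      have h1 : (σ ^ (n + 1))⁻¹ v = (τ (β ((σ ^ n)⁻¹ v)))⁻¹ ((σ ^ n)⁻¹ v) := by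
        rw [pow_succ, mul_inv_rev]; rfl
      refine ⟨?_, ?_⟩
      · rw [h1, ih.2, ih.1, pow_succ, mul_inv_rev]; rfl
      · rw [h1, hβ', ih.2]
  obtain ⟨n, hn⟩ := (hτ (β v)).2 (show v ∈ {u | β u = β v} from rfl)
    (show w ∈ {u | β u = β v} from hvw.symm)
  refine ⟨n, ?_⟩
  obtain ⟨m, rfl | rfl⟩ := n.eq_nat_or_neg
  · simpa [(hpow m).1] using hn
  · simpa [(hpow' m).1] using hn

theorem formPerm_append_cons_cons [DecidableEq V] {l₁ l₂ : List V} {u v : V}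
    (h : (l₁ ++ u :: v :: l₂).Nodup) : (l₁ ++ u :: v :: l₂).formPerm u = v := by
  have := List.formPerm_apply_lt_getElem _ h l₁.length (by simp)
  simpa using this

/-- The second `a` in the chain accounts for the arc from the last entry back to the first. -/
theorem rel_formPerm [DecidableEq V] {R : V → V → Prop} {a : V} {l : List V}
    (hn : (a :: l).Nodup) (hc : List.IsChain R (a :: (l ++ [a]))) {v : V} (hv : v ∈ a :: l) :
    R v ((a :: l).formPerm v) := by
  obtain ⟨i, hi, rfl⟩ := List.mem_iff_getElem.1 hv
  rw [List.formPerm_apply_getElem _ hn i hi]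
  have h := List.isChain_iff_getElem.1 hc i (by simp at hi ⊢; omega)
  have e1 : (a :: (l ++ [a]))[i]'(by simp at hi ⊢; omega) = (a :: l)[i] := by
    simp only [← List.cons_append]
    rw [List.getElem_append_left]
  rw [e1] at h
  convert h using 1
  simp only [← List.cons_append]
  by_cases hlt : i + 1 < (a :: l).length
  · rw [List.getElem_append_left hlt]
    congr 1
    exact Nat.mod_eq_of_lt hlt
  · have : i + 1 = (a :: l).length := by omega
    simp only [this, Nat.mod_self]
    simp

theorem exists_isCycleOn [Finite V] (s : Set V) : ∃ τ : Perm V, τ.IsCycleOn s := by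
  obtain ⟨τ, h, -⟩ := s.toFinite.countable.exists_cycleOn
  exact ⟨τ, h⟩

end Perm

end RGG

/-! ### Exit edges in 2-connected graphs. -/

namespace RGG

section Connectivity

variable {α : Type*} {G : SimpleGraph α}

theorem IsKConnected.exists_adj_of_notMem (h : IsKConnected G 2) {S A : Set α}
    (hS : S.Subsingleton) {a b : α} (ha : a ∈ A) (haS : a ∉ S) (hb : b ∉ A) (hbS : b ∉ S) :
    ∃ u v, u ∈ A ∧ u ∉ S ∧ v ∉ A ∧ v ∉ S ∧ G.Adj u v := by
  have hS2 : S.encard < ((2 : ℕ) : ℕ∞) :=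
    lt_of_le_of_lt (Set.encard_le_one_iff_subsingleton.2 hS) (by norm_num)
  obtain ⟨p⟩ := (h.2 S hS2).preconnected ⟨a, haS⟩ ⟨b, hbS⟩
  obtain ⟨d, -, hd1, hd2⟩ := p.exists_boundary_dart {x | (x : α) ∈ A} ha hb
  exact ⟨d.fst, d.snd, hd1, d.fst.2, hd2, d.snd.2, d.adj⟩

/-- In a 2-connected graph there are two edges between a nonempty set and its complement that are
disjoint, except possibly in the set if that has a single element. -/
theorem IsKConnected.exists_crossing_edges (h : IsKConnected G 2) {A : Set α}
    (hA : A.Nonempty) {c d : α} (hc : c ∉ A) (hd : d ∉ A) (hcd : c ≠ d) :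
    ∃ a₁ a₂ b₁ b₂, a₁ ∈ A ∧ a₂ ∈ A ∧ b₁ ∉ A ∧ b₂ ∉ A ∧ b₁ ≠ b₂ ∧ G.Adj a₁ b₁ ∧ G.Adj a₂ b₂ ∧
      (a₁ ≠ a₂ ∨ A = {a₁}) := by
  have hout : ∀ b : α, ∃ e, e ∉ A ∧ e ∉ ({b} : Set α) := fun b => by
    by_cases hb : c = b
    · exact ⟨d, hd, fun h => hcd (hb.trans h.symm)⟩
    · exact ⟨c, hc, hb⟩
  obtain ⟨a₀, ha₀⟩ := hA
  -- Deleting nothing gives an edge `a b`; deleting `b` gives `a' b'` with `b' ≠ b`. If `a' = a` and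
  -- `A` has another element, deleting `a` gives a third edge, whose outer end differs from `b` or
  -- from `b'`.
  obtain ⟨a, b, ha, -, hb, -, hab⟩ :=
    h.exists_adj_of_notMem Set.subsingleton_empty ha₀ (by simp) hc (by simp)
  obtain ⟨e, he, heb⟩ := hout b
  obtain ⟨a', b', ha', -, hb', hb'b, hab'⟩ :=
    h.exists_adj_of_notMem (Set.subsingleton_singleton (a := b)) ha
      (by rintro rfl; exact hb ha) he heb
  have hb'b : b' ≠ b := hb'b
  by_cases hsing : A = {a}
  · exact ⟨a, a', b, b', ha, ha', hb, hb', hb'b.symm, hab, hab', Or.inr hsing⟩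
  by_cases haa' : a = a'
  · subst haa'
    obtain ⟨x, hx, hxa⟩ : ∃ x ∈ A, x ≠ a := by
      by_contra! hcon
      exact hsing (Set.eq_singleton_iff_unique_mem.2 ⟨ha, hcon⟩)
    obtain ⟨a'', b'', ha'', ha''a, hb'', -, hab''⟩ :=
      h.exists_adj_of_notMem (Set.subsingleton_singleton (a := a)) hx hxa he
        (by rintro rfl; exact he ha)
    have ha''a : a ≠ a'' := fun h => ha''a h.symm
    by_cases hbb : b'' = b
    · exact ⟨a, a'', b', b'', ha, ha'', hb', hb'', by rwa [hbb], hab', hab'', Or.inl ha''a⟩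
    · exact ⟨a, a'', b, b'', ha, ha'', hb, hb'', Ne.symm hbb, hab, hab'', Or.inl ha''a⟩
  · exact ⟨a, a', b, b', ha, ha', hb, hb', hb'b.symm, hab, hab', Or.inl haa'⟩

end Connectivity

end RGG

/-! ### Geometry of grid cells and of squares. -/

namespace RGG

section Geometry

theorem norm_lt_of_forall_abs_lt {u : Plane} {a : ℝ} (h : ∀ i, |u i| < a) :
    ‖u‖ < a * Real.sqrt 2 := by
  have ha : 0 < a := lt_of_le_of_lt (abs_nonneg _) (h 0)
  rw [EuclideanSpace.norm_eq, Real.sqrt_lt' (by positivity), mul_pow,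
    Real.sq_sqrt (by norm_num), Fin.sum_univ_two]
  have h0 := h 0
  have h1 := h 1
  have := pow_lt_pow_left₀ h0 (abs_nonneg _) two_ne_zero
  have := pow_lt_pow_left₀ h1 (abs_nonneg _) two_ne_zero
  simp only [Real.norm_eq_abs]
  linarith

theorem abs_coord_le_dist (p q : Plane) (i : Fin 2) : |p i - q i| ≤ dist p q := by
  rw [dist_eq_norm]
  simpa using PiLp.norm_apply_le (p - q) i

variable {η r : ℝ}

/-- `r'` is `r` minus the diagonal of a cell, and the displacements of `v` and `w` from their
corners differ by less than that diagonal. Closeness of vertices is therefore always checked on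
corners. -/
theorem dist_lt_of_mem_cell {p q v w : Plane} (hv : v ∈ cell η r p) (hw : w ∈ cell η r q)
    (h : dist p q ≤ rPrime η r) : dist v w < r := by
  have h1 : ‖(v - p) - (w - q)‖ < (η * r) * Real.sqrt 2 := by
    refine norm_lt_of_forall_abs_lt fun i => ?_
    have := hv i
    have := hw i
    simp only [PiLp.sub_apply]
    rw [abs_lt]
    constructor <;> linarith
  have h2 : v - w = (p - q) + ((v - p) - (w - q)) := by abel
  have h3 : dist v w ≤ dist p q + ‖(v - p) - (w - q)‖ := by
    rw [dist_eq_norm, dist_eq_norm, h2]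
    exact norm_add_le _ _
  unfold rPrime at h
  linarith

theorem dist_cell_lt (hη : 0 < η) (hr : 0 < r) (hη₁ : η * Real.sqrt 2 < 1) {p v : Plane}
    (hv : v ∈ cell η r p) : dist v p < r := by
  have h1 : ‖v - p‖ < (η * r) * Real.sqrt 2 := by
    refine norm_lt_of_forall_abs_lt fun i => ?_
    have := hv i
    simp only [PiLp.sub_apply]
    rw [abs_lt]
    constructor
    · have : 0 < η * r := by positivity
      linarith
    · linarith
  rw [dist_eq_norm]
  nlinarith

/-- The corner of the grid cell that contains `v`. -/
noncomputable def corner (η r : ℝ) (v : Plane) : Plane :=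
  WithLp.toLp 2 fun i => (⌊v i / (η * r)⌋ : ℝ) * (η * r)

theorem mem_cell_corner (h : 0 < η * r) (v : Plane) : v ∈ cell η r (corner η r v) := by
  intro i
  have h1 := Int.floor_le (v i / (η * r))
  have h2 := Int.lt_floor_add_one (v i / (η * r))
  rw [le_div_iff₀ h] at h1
  rw [div_lt_iff₀ h] at h2
  simp only [corner]
  constructor <;> linarith

theorem corner_mem_gridPoints (h : 0 < η * r) {v : Plane} (hv : v ∈ unitSquare) :
    corner η r v ∈ gridPoints η r := by
  refine ⟨fun i => ⟨?_, (mem_cell_corner h v i).1.trans (hv i).2⟩, fun i => ⟨_, rfl⟩⟩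
  have : (0 : ℝ) ≤ (⌊v i / (η * r)⌋ : ℝ) := by
    exact_mod_cast Int.floor_nonneg.2 (div_nonneg (hv i).1 h.le)
  simp only [corner]
  positivity

theorem corner_eq_of_mem_cell (h : 0 < η * r) {p v : Plane} (hp : p ∈ gridPoints η r)
    (hv : v ∈ cell η r p) : corner η r v = p := by
  ext i
  obtain ⟨k, hk⟩ := hp.2 i
  have := hv i
  simp only [corner]
  rw [hk] at this ⊢
  congr 2
  rw [Int.floor_eq_iff, le_div_iff₀ h, div_lt_iff₀ h]
  constructor <;> linarith

/-- The index of the square of side `7/10 s` that contains `p`. -/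
noncomputable def squareIndex (s : ℝ) (p : Plane) : ℤ × ℤ :=
  (⌊p 0 / (7 / 10 * s)⌋, ⌊p 1 / (7 / 10 * s)⌋)

theorem abs_sub_lt_of_floor_eq {a b t : ℝ} (ht : 0 < t) (h : ⌊a / t⌋ = ⌊b / t⌋) :
    |a - b| < t := by
  have := Int.abs_sub_lt_one_of_floor_eq_floor h
  rwa [← sub_div, abs_div, abs_of_pos ht, div_lt_one ht] at this

/-- The diagonal of the square is below `s` because `7/10 * √2 < 1`. -/
theorem dist_lt_of_squareIndex_eq {s : ℝ} (hs : 0 < s) {p q : Plane}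
    (h : squareIndex s p = squareIndex s q) : dist p q < s := by
  rw [squareIndex, squareIndex, Prod.mk.injEq] at h
  have ht : 0 < 7 / 10 * s := by positivity
  have h1 : ‖p - q‖ < (7 / 10 * s) * Real.sqrt 2 := by
    refine norm_lt_of_forall_abs_lt fun i => ?_
    fin_cases i
    · exact abs_sub_lt_of_floor_eq ht h.1
    · exact abs_sub_lt_of_floor_eq ht h.2
  have h2 : Real.sqrt 2 < 10 / 7 := by
    rw [Real.sqrt_lt' (by norm_num)]; norm_num
  rw [dist_eq_norm]
  nlinarith

theorem abs_floor_sub_floor_le {a b t : ℝ} (ht : 0 < t) (h : |a - b| ≤ 2 * t) :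
    -2 ≤ ⌊a / t⌋ - ⌊b / t⌋ ∧ ⌊a / t⌋ - ⌊b / t⌋ ≤ 2 := by
  have h1 : |a / t - b / t| ≤ 2 := by
    rwa [← sub_div, abs_div, abs_of_pos ht, div_le_iff₀ ht]
  rw [abs_le] at h1
  have := Int.floor_le (a / t)
  have := Int.lt_floor_add_one (a / t)
  have := Int.floor_le (b / t)
  have := Int.lt_floor_add_one (b / t)
  have h3 : (-3 : ℝ) < ((⌊a / t⌋ - ⌊b / t⌋ : ℤ) : ℝ) := by push_cast; linarith
  have h4 : ((⌊a / t⌋ - ⌊b / t⌋ : ℤ) : ℝ) < 3 := by push_cast; linarith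
  have h3 : (-3 : ℤ) < ⌊a / t⌋ - ⌊b / t⌋ := by exact_mod_cast h3
  have h4 : ⌊a / t⌋ - ⌊b / t⌋ < (3 : ℤ) := by exact_mod_cast h4
  omega

/-- The possible differences of the indices of squares of two points at distance at most `s`. -/
noncomputable abbrev offsets : Finset (ℤ × ℤ) := Finset.Icc (-2) 2 ×ˢ Finset.Icc (-2) 2

/-- As `s` is at most twice the side `7/10 * s`, each index changes by at most 2, which leaves 25
offsets. -/
theorem squareIndex_sub_mem_offsets {s : ℝ} (hs : 0 < s) {p q : Plane} (h : dist p q ≤ s) :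
    squareIndex s q - squareIndex s p ∈ offsets := by
  have ht : 0 < 7 / 10 * s := by positivity
  rw [dist_comm] at h
  have h0 := (abs_coord_le_dist q p 0).trans h
  have h1 := (abs_coord_le_dist q p 1).trans h
  have h0 := abs_floor_sub_floor_le ht (h0.trans (by linarith : s ≤ 2 * (7 / 10 * s)))
  have h1 := abs_floor_sub_floor_le ht (h1.trans (by linarith : s ≤ 2 * (7 / 10 * s)))
  simp only [squareIndex, Prod.mk_sub_mk, Finset.mem_product, Finset.mem_Icc]
  exact ⟨h0, h1⟩

end Geometry

end RGG

/-! ### Merging the orbits of adjacent dense cells. -/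

namespace RGG

open Equiv Function

/-- Labels for the places of a cell at which orbits may be merged. -/
abbrev Slot : Type := Fin 4 ⊕ Fin 3 × offsets

theorem card_slot : Fintype.card Slot = 79 := by
  simp only [Slot, Fintype.card_sum, Fintype.card_prod, Fintype.card_fin, Fintype.card_coe,
    Finset.card_product, Int.card_Icc]
  rfl

/-- The number of neighbours of a cell is not bounded independently of `η`, so a slot per neighbour
is not available. Cells of one square are pairwise adjacent and are chained cyclically; then each
pair of squares that contains an adjacent pair of cells needs one merge only. Slots `.inl 2`, `.inl
3` and `.inr (2, o)` stay untouched for ears and cliques. -/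
theorem exists_merges_cells {V D : Type*} [Finite V] [Finite D] {R : V → V → Prop} {σ : Perm V}
    (hσ : ∀ v, R v (σ v)) (adj : D → D → Prop) (hsymm : ∀ q q', adj q q' → adj q' q)
    (s : D × Slot → V) (hs : Injective s)
    (hR : ∀ q q' t t', q = q' ∨ adj q q' → R (s (q, t)) (σ (s (q', t'))))
    (hcyc : ∀ q t t', σ.SameCycle (s (q, t)) (s (q, t')))
    (sq : D → ℤ × ℤ) (hsq : ∀ q q', sq q = sq q' → q = q' ∨ adj q q')
    (hoff : ∀ q q', adj q q' → sq q' - sq q ∈ offsets) :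
    ∃ σ', Merges R {v | ∃ q t, v = s (q, t) ∧
        (t = .inl 0 ∨ t = .inl 1 ∨ (∃ o, t = .inr (0, o)) ∨ ∃ o, t = .inr (1, o))} σ σ' ∧
      ∀ q q' t t', adj q q' → σ'.SameCycle (s (q, t)) (s (q', t')) := by
  classical
  choose τ hτ using fun l : ℤ × ℤ => exists_isCycleOn {q : D | sq q = l}
  obtain ⟨c, hc, hcsame⟩ := exists_perm_glue sq τ hτ
  have hcsq : ∀ q, sq (c q) = sq q := fun q => by
    rw [hc]; exact (hτ (sq q)).apply_mem_iff.2 rfl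
  have hinj : ∀ {q q' t t'}, s (q, t) = s (q', t') → q = q' ∧ t = t' := fun h =>
    Prod.mk.inj (hs h)
  -- Each cell occurs once as `q` and once as `c q`, so two slots per cell suffice.
  obtain ⟨σ₁, hm₁, hsame₁⟩ := exists_merges_pairs hσ
    (fun q : D => s (q, .inl 0)) (fun q => s (c q, .inl 1))
    (by
      rintro (a | a) (b | b) h <;> simp only [Sum.elim_inl, Sum.elim_inr] at h
      · rw [(hinj h).1]
      · exact absurd (hinj h).2 (by simp)
      · exact absurd (hinj h).2 (by simp)
      · rw [c.injective (hinj h).1])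
    (fun q => hR _ _ _ _ (hsq _ _ (hcsq q).symm)) (fun q => hR _ _ _ _ (hsq _ _ (hcsq q)))
  have hcyc₁ : ∀ q t t', σ₁.SameCycle (s (q, t)) (s (q, t')) := fun q t t' =>
    hm₁.coarser _ _ (hcyc q t t')
  have hchain : ∀ q q' t t', sq q = sq q' → σ₁.SameCycle (s (q, t)) (s (q', t')) := by
    intro q q' t t' h
    obtain ⟨n, rfl⟩ := (hcsame q q' h).exists_nat_pow_eq
    clear h
    induction n generalizing t' with
    | zero => exact hcyc₁ _ _ _
    | succ n ih =>
      have h1 := hsame₁ ((c ^ n) q)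
      rw [pow_succ']
      exact ((ih (.inl 0)).trans h1).trans (hcyc₁ _ _ _)
  let P := {p : D × D // adj p.1 p.2}
  let ends : P → (ℤ × ℤ) × (ℤ × ℤ) := fun p => (sq p.1.1, sq p.1.2)
  let e : Set.range ends → P := fun i => i.2.choose
  have he : ∀ i, ends (e i) = i := fun i => i.2.choose_spec
  let off : P → offsets := fun p => ⟨sq p.1.2 - sq p.1.1, hoff _ _ p.2⟩
  have heinj : ∀ i j, sq (e i).1.1 = sq (e j).1.1 → sq (e i).1.2 = sq (e j).1.2 → i = j := by
    intro i j h1 h2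
    apply Subtype.ext
    rw [← he i, ← he j]
    exact Prod.ext h1 h2
  have hag : ∀ q k o, k ≠ 2 → σ₁ (s (q, .inr (k, o))) = σ (s (q, .inr (k, o))) := by
    intro q k o _
    refine hm₁.agree _ ?_
    rintro (⟨q', h⟩ | ⟨q', h⟩) <;> exact absurd (hinj h).2 (by simp)
  -- A cell determines one square of the pair and the offset the other, so no slot serves two pairs.
  obtain ⟨σ₂, hm₂, hsame₂⟩ := exists_merges_pairs hm₁.rel
    (fun i : Set.range ends => s ((e i).1.1, .inr (0, off (e i))))
    (fun i => s ((e i).1.2, .inr (1, off (e i))))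
    (by
      rintro (a | a) (b | b) h <;> simp only [Sum.elim_inl, Sum.elim_inr] at h
      · obtain ⟨h1, h2⟩ := hinj h
        have h2 : (off (e a) : ℤ × ℤ) = off (e b) := by
          simpa using congrArg Subtype.val (Prod.mk.inj (Sum.inr_injective h2)).2
        simp only [off, h1, sub_left_inj] at h2
        rw [heinj a b (by rw [h1]) h2]
      · exact absurd (hinj h).2 (by simp)
      · exact absurd (hinj h).2 (by simp)
      · obtain ⟨h1, h2⟩ := hinj h
        have h2 : (off (e a) : ℤ × ℤ) = off (e b) := by
          simpa using congrArg Subtype.val (Prod.mk.inj (Sum.inr_injective h2)).2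
        simp only [off, h1, sub_right_inj] at h2
        rw [heinj a b h2 (by rw [h1])])
    (fun i => by rw [hag _ _ _ (by decide)]; exact hR _ _ _ _ (Or.inr (e i).2))
    (fun i => by rw [hag _ _ _ (by decide)]; exact hR _ _ _ _ (Or.inr (hsymm _ _ (e i).2)))
  refine ⟨σ₂, (hm₁.trans hm₂).mono ?_, fun q q' t t' h => ?_⟩
  · rintro v ((⟨q, rfl⟩ | ⟨q, rfl⟩) | (⟨q, rfl⟩ | ⟨q, rfl⟩))
    · exact ⟨_, _, rfl, Or.inl rfl⟩
    · exact ⟨_, _, rfl, Or.inr (Or.inl rfl)⟩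
    · exact ⟨_, _, rfl, Or.inr (Or.inr (Or.inl ⟨_, rfl⟩))⟩
    · exact ⟨_, _, rfl, Or.inr (Or.inr (Or.inr ⟨_, rfl⟩))⟩
  · let i : Set.range ends := ⟨ends ⟨(q, q'), h⟩, _, rfl⟩
    have hi := he i
    have h1 : sq q = sq (e i).1.1 := (congrArg Prod.fst hi).symm
    have h2 : sq (e i).1.2 = sq q' := congrArg Prod.snd hi
    exact ((hm₂.coarser _ _ (hchain _ _ _ _ h1)).trans (hsame₂ i)).trans
      (hm₂.coarser _ _ (hchain _ _ _ _ h2))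

end RGG

/-! ### Obstructions and their separation. -/

namespace RGG

open Equiv Function

/-- The hypotheses on the parameters and on the point set. -/
structure IsConfig (η r ρ : ℝ) (V : Set Plane) : Prop where
  eta_pos : 0 < η
  eta_lt : η < 1 / Real.sqrt 2
  r_pos : 0 < r
  subset : V ⊆ unitSquare
  finite : V.Finite
  p1 : P1 η V r
  p2 : P2 η V r
  p3 : P3 η V r
  p4 : P4 η V r
  p5 : P5 η V r
  p6 : P6 η V r
  le_rho : r ≤ ρ
  rho_le : ρ ≤ 2 * r
  conn : IsKConnected (geomGraph V ρ) 2

/-- A dense point is small if its component has diameter less than `r'`. -/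
def IsSmall {η : ℝ} {V : Set Plane} {r : ℝ} (q : densePoints η V r) : Prop :=
  compDiam ((denseGraph η V r).connectedComponentMk q) < rPrime η r

/-- The points of the small components together with the bad points. -/
def obstructionPoints (η : ℝ) (V : Set Plane) (r : ℝ) : Set Plane :=
  {x | ∃ q : densePoints η V r, IsSmall q ∧ (q : Plane) = x} ∪ badPoints η V r

/-- A representative of the cluster of obstruction points around `p`. -/
noncomputable def rep (η : ℝ) (V : Set Plane) (r : ℝ) (p : Plane) : Plane :=
  Classical.epsilon (· ∈ {y | y ∈ obstructionPoints η V r ∧ dist p y ≤ 500 * r})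

/-- A vertex is near the giant if it is close to a dense point that is not small. -/
def NearGiant (η : ℝ) (V : Set Plane) (r : ℝ) (v : Plane) : Prop :=
  ∃ q : densePoints η V r, ¬ IsSmall q ∧ dist (q : Plane) (corner η r v) ≤ rPrime η r

/-- The vertices belonging to the cluster of obstruction points with representative `o`. -/
def obstruction (η : ℝ) (V : Set Plane) (r : ℝ) (o : Plane) : Set V :=
  {v | ¬ NearGiant η V r v ∧ rep η V r (corner η r v) = o}

namespace IsConfig

variable {η r ρ : ℝ} {V : Set Plane}

theorem eq_or_adj {q q' : densePoints η V r} (hd : dist (q : Plane) q' ≤ rPrime η r) :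
    q = q' ∨ (denseGraph η V r).Adj q q' := by
  by_cases hq : q = q'
  · exact Or.inl hq
  · exact Or.inr ⟨hq, hd⟩

theorem isSmall_congr {q q' : densePoints η V r} (hr : (denseGraph η V r).Reachable q q') :
    IsSmall q ↔ IsSmall q' := by
  unfold IsSmall
  rw [SimpleGraph.ConnectedComponent.sound hr]

theorem isSmall_of_dist_le {q q' : densePoints η V r} (hq : IsSmall q)
    (hd : dist (q : Plane) q' ≤ rPrime η r) : IsSmall q' := by
  rcases eq_or_adj hd with rfl | hadj
  · exact hq
  · exact (isSmall_congr hadj.reachable).1 hq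

theorem mem_obstruction_of_corner_eq {v : V} {q : densePoints η V r} (hq : IsSmall q)
    (hv : corner η r v = q) : v ∈ obstruction η V r (rep η V r q) := by
  refine ⟨fun ⟨q', hq', hd⟩ => hq' (isSmall_of_dist_le hq ?_), by rw [hv]⟩
  rwa [dist_comm, ← hv]

section

variable (h : IsConfig η r ρ V)
include h

theorem eta_mul_lt : η * Real.sqrt 2 < 1 := by
  have := h.eta_lt
  rwa [lt_div_iff₀ (by positivity)] at this

theorem rPrime_pos : 0 < rPrime η r := by
  have := h.eta_mul_lt
  exact mul_pos h.r_pos (by linarith)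

theorem rPrime_lt : rPrime η r < r := by
  have := h.eta_pos
  have := h.r_pos
  have : 0 < r * (η * Real.sqrt 2) := by positivity
  unfold rPrime
  linarith

theorem side_pos : 0 < η * r := mul_pos h.eta_pos h.r_pos

theorem dist_corner_lt (v : Plane) : dist v (corner η r v) < r :=
  dist_cell_lt h.eta_pos h.r_pos h.eta_mul_lt (mem_cell_corner h.side_pos v)

theorem dist_lt_of_corner {v w : Plane}
    (hvw : dist (corner η r v) (corner η r w) ≤ rPrime η r) : dist v w < r :=
  dist_lt_of_mem_cell (mem_cell_corner h.side_pos v) (mem_cell_corner h.side_pos w) hvw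

theorem dist_le_rho_of_corner {v w : Plane}
    (hvw : dist (corner η r v) (corner η r w) ≤ rPrime η r) : dist v w ≤ ρ :=
  (h.dist_lt_of_corner hvw).le.trans h.le_rho

theorem hundred_le_ncard (q : densePoints η V r) :
    100 ≤ {v : V | corner η r v = q}.ncard := by
  have hfin := h.finite
  have h1 := q.2.2
  have h2 : ((↑) : V → Plane) '' {v : V | corner η r v = q} = V ∩ cell η r q := by
    ext x
    constructor
    · rintro ⟨v, hv, rfl⟩
      refine ⟨v.2, ?_⟩
      have hv : corner η r v = q := hv
      rw [← hv]
      exact mem_cell_corner h.side_pos v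
    · rintro ⟨hx, hxq⟩
      exact ⟨⟨x, hx⟩, corner_eq_of_mem_cell h.side_pos q.2.1 hxq, rfl⟩
  rw [← h2, Subtype.val_injective.encard_image] at h1
  have : Finite V := hfin
  rw [← Set.Finite.cast_ncard_eq (Set.toFinite _)] at h1
  exact_mod_cast h1

theorem exists_corner_notMem (q : densePoints η V r) (s : Set V) (hs : s.ncard < 100) :
    ∃ v : V, corner η r v = q ∧ v ∉ s := by
  have : Finite V := h.finite
  have h1 := h.hundred_le_ncard q
  obtain ⟨v, hv, hvs⟩ := Set.exists_mem_notMem_of_ncard_lt_ncard (hs.trans_le h1)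
  exact ⟨v, hv, hvs⟩

theorem finite_dense : Finite (densePoints η V r) := by
  have : Finite V := h.finite
  choose f hf _ using fun q => h.exists_corner_notMem q ∅ (by simp)
  exact Finite.of_injective f fun q q' hq => Subtype.ext (by rw [← hf q, ← hf q', hq])

theorem corner_mem (v : V) : corner η r v ∈ gridPoints η r :=
  corner_mem_gridPoints h.side_pos (h.subset v.2)

theorem bad_or_exists_dense (v : V) : corner η r v ∈ badPoints η V r ∨
    ∃ q : densePoints η V r, dist (q : Plane) (corner η r v) ≤ rPrime η r := by
  by_contra! hcon
  exact hcon.1 ⟨h.corner_mem v, fun q _ hq hqd => absurd hq (not_le.2 (hcon.2 ⟨q, hqd⟩))⟩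

theorem dist_lt_of_small {q q' : densePoints η V r} (hq : IsSmall q) (hq' : IsSmall q')
    (hd : dist (q : Plane) q' ≤ 1000 * r) : dist (q : Plane) q' < rPrime η r := by
  by_cases hc : (denseGraph η V r).connectedComponentMk q =
      (denseGraph η V r).connectedComponentMk q'
  · have := h.finite_dense
    refine lt_of_le_of_lt (Metric.dist_le_diam_of_mem (Set.toFinite _).isBounded ?_ ?_) hq
    · exact ⟨q, SimpleGraph.ConnectedComponent.connectedComponentMk_mem, rfl⟩
    · exact ⟨q', hc.symm, rfl⟩
  · exact absurd hd (not_le.2 (h.p2 _ _ hc hq hq' q rfl q' rfl))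

theorem lt_dist_bad {q : densePoints η V r} (hq : IsSmall q) {p : Plane}
    (hp : p ∈ badPoints η V r) : 1000 * r < dist (q : Plane) p :=
  h.p3 _ hq q rfl p hp

/-- (P2), (P3) and (P4) combine into one gap: no distance lies between `r'` and `1000 r`. A small
point and a bad point are never close, so clusters are of one kind. -/
theorem dist_lt_of_obstructionPoints {x y : Plane} (hx : x ∈ obstructionPoints η V r)
    (hy : y ∈ obstructionPoints η V r) (hd : dist x y ≤ 1000 * r) : dist x y < rPrime η r := by
  rcases hx with ⟨q, hq, rfl⟩ | hx <;> rcases hy with ⟨q', hq', rfl⟩ | hy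
  · exact h.dist_lt_of_small hq hq' hd
  · exact absurd hd (not_le.2 (h.lt_dist_bad hq hy))
  · rw [dist_comm] at hd
    exact absurd hd (not_le.2 (h.lt_dist_bad hq' hx))
  · exact (h.p4 x hx y hy).resolve_right (not_lt.2 hd)

theorem reachable_of_not_isSmall {q q' : densePoints η V r} (hq : ¬ IsSmall q)
    (hq' : ¬ IsSmall q') : (denseGraph η V r).Reachable q q' :=
  SimpleGraph.ConnectedComponent.exact (h.p6.unique (not_lt.1 hq) (not_lt.1 hq'))

theorem exists_not_isSmall : ∃ q : densePoints η V r, ¬ IsSmall q := by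
  obtain ⟨C, hC, -⟩ := h.p6
  obtain ⟨q, rfl⟩ := C.exists_rep
  exact ⟨q, not_lt.2 hC⟩

/-- `Classical.epsilon` depends only on the set of candidates, and the gap makes the two sets equal:
`400 r + 500 r` is below `1000 r`, and `400 r + r'` is below `500 r`. -/
theorem rep_eq {p x : Plane} (hx : x ∈ obstructionPoints η V r) (hd : dist p x ≤ 400 * r) :
    rep η V r p = rep η V r x := by
  have hr := h.r_pos
  have hr' := h.rPrime_lt
  have hS : {y | y ∈ obstructionPoints η V r ∧ dist p y ≤ 500 * r} =
      {y | y ∈ obstructionPoints η V r ∧ dist x y ≤ 500 * r} := by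
    ext y
    constructor
    · rintro ⟨hy, hpy⟩
      have h1 := dist_triangle_left x y p
      have := h.dist_lt_of_obstructionPoints hx hy (by linarith)
      exact ⟨hy, by linarith⟩
    · rintro ⟨hy, hxy⟩
      have := h.dist_lt_of_obstructionPoints hx hy (by linarith)
      have := dist_triangle p x y
      exact ⟨hy, by linarith⟩
  unfold rep
  rw [hS]

theorem rep_mem {x : Plane} (hx : x ∈ obstructionPoints η V r) :
    rep η V r x ∈ obstructionPoints η V r ∧ dist x (rep η V r x) < rPrime η r := by
  have hr := h.r_pos
  have hne : {y | y ∈ obstructionPoints η V r ∧ dist x y ≤ 500 * r}.Nonempty :=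
    ⟨x, hx, by simp; linarith⟩
  obtain ⟨h2, h3⟩ := Classical.epsilon_spec hne
  exact ⟨h2, h.dist_lt_of_obstructionPoints hx h2 (h3.trans (by linarith))⟩

theorem dist_lt_of_rep_eq {x y : Plane} (hx : x ∈ obstructionPoints η V r)
    (hy : y ∈ obstructionPoints η V r) (he : rep η V r x = rep η V r y) :
    dist x y < rPrime η r := by
  have hr := h.r_pos
  have hr' := h.rPrime_lt
  have h1 := (h.rep_mem hx).2
  have h2 := (h.rep_mem hy).2
  rw [he] at h1
  have := dist_triangle_right x y (rep η V r y)
  exact h.dist_lt_of_obstructionPoints hx hy (by linarith)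

theorem exists_obstructionPoint {v : V} (hv : ¬ NearGiant η V r v) :
    corner η r v ∈ badPoints η V r ∨ ∃ q : densePoints η V r, IsSmall q ∧
      dist (q : Plane) (corner η r v) ≤ rPrime η r := by
  refine (h.bad_or_exists_dense v).imp_right fun ⟨q, hq⟩ => ⟨q, ?_, hq⟩
  by_contra hs
  exact hv ⟨q, hs, hq⟩

theorem rep_corner_eq {v : V} {x : Plane} (hx : x ∈ obstructionPoints η V r)
    (hd : dist x (corner η r v) ≤ rPrime η r) :
    rep η V r (corner η r v) = rep η V r x := by
  have hr := h.r_pos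
  have hr' := h.rPrime_lt
  rw [dist_comm] at hd
  exact h.rep_eq hx (by linarith)

theorem rep_corner_mem {v : V} (hv : ¬ NearGiant η V r v) :
    rep η V r (corner η r v) ∈ obstructionPoints η V r ∧
      dist (rep η V r (corner η r v)) v < 3 * r := by
  have hr' := h.rPrime_lt
  have hpos := h.rPrime_pos
  obtain ⟨x, hx, hxv⟩ : ∃ x ∈ obstructionPoints η V r,
      dist x (corner η r v) ≤ rPrime η r := by
    rcases h.exists_obstructionPoint hv with hb | ⟨q, hq, hqv⟩
    · exact ⟨_, Or.inr hb, by simpa using hpos.le⟩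
    · exact ⟨q, Or.inl ⟨q, hq, rfl⟩, hqv⟩
  rw [h.rep_corner_eq hx hxv]
  obtain ⟨h1, h2⟩ := h.rep_mem hx
  refine ⟨h1, ?_⟩
  have h3 := h.dist_corner_lt v
  have := dist_triangle_left (rep η V r x) (corner η r v) x
  have := dist_triangle_right (rep η V r x) v (corner η r v)
  linarith

theorem rep_rep_corner {v : V} (hv : ¬ NearGiant η V r v) :
    rep η V r (rep η V r (corner η r v)) = rep η V r (corner η r v) := by
  have hr' := h.rPrime_lt
  have hr := h.r_pos
  have h1 := h.rep_corner_mem hv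
  have h2 := h.dist_corner_lt v
  rw [dist_comm] at h2
  refine (h.rep_eq h1.1 ?_).symm
  have := dist_triangle_right (corner η r v) (rep η V r (corner η r v)) v
  linarith

theorem lt_dist_rep_of_ne {v w : V} (hv : ¬ NearGiant η V r v) (hw : ¬ NearGiant η V r w)
    (hne : rep η V r (corner η r v) ≠ rep η V r (corner η r w)) :
    1000 * r < dist (rep η V r (corner η r v)) (rep η V r (corner η r w)) := by
  by_contra! hd
  have hr' := h.rPrime_lt
  have hr := h.r_pos
  have h1 := h.dist_lt_of_obstructionPoints (h.rep_corner_mem hv).1 (h.rep_corner_mem hw).1 hd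
  have := h.rep_eq (h.rep_corner_mem hw).1 (h1.le.trans (by linarith))
  rw [h.rep_rep_corner hv, h.rep_rep_corner hw] at this
  exact hne this

theorem nearGiant_of_corner_eq {v : V} {q : densePoints η V r} (hq : ¬ IsSmall q)
    (hv : corner η r v = q) : NearGiant η V r v :=
  ⟨q, hq, by rw [hv]; simpa using h.rPrime_pos.le⟩

/-- Otherwise `b` lies in another obstruction, whose representative is within `3 r + 2 r + 3 r` of
that of `a`. -/
theorem nearGiant_of_adj {o : Plane} {a b : V} (ha : a ∈ obstruction η V r o)
    (hb : b ∉ obstruction η V r o) (hd : dist (a : Plane) b ≤ ρ) : NearGiant η V r b := by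
  by_contra hcon
  have hne : rep η V r (corner η r a) ≠ rep η V r (corner η r b) := fun he =>
    hb ⟨hcon, by rw [← he, ha.2]⟩
  have h1 := h.lt_dist_rep_of_ne ha.1 hcon hne
  have h2 := (h.rep_corner_mem ha.1).2
  have h3 := (h.rep_corner_mem hcon).2
  have hr := h.r_pos
  have hρ := h.rho_le
  have := dist_triangle4 (rep η V r (corner η r a)) a b (rep η V r (corner η r b))
  rw [dist_comm (b : Plane)] at this
  linarith

end

end IsConfig

end RGG

/-! ### Ears: cycles through an obstruction and the giant. -/

namespace RGG

open Equiv Function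

namespace IsConfig

variable {η r ρ : ℝ} {V : Set Plane}

/-- Two vertices, each joined to an end of a path in an obstruction, and a path between them
through the giant close the path to a cycle. -/
theorem exists_ear_of_path [DecidableEq V] (h : IsConfig η r ρ V) {o : Plane} {a₁ a₂ b₁ b₂ : V}
    (ha₁ : a₁ ∈ obstruction η V r o) (ha₂ : a₂ ∈ obstruction η V r o)
    (hb₁ : b₁ ∉ obstruction η V r o) (hb₂ : b₂ ∉ obstruction η V r o) (hb : b₁ ≠ b₂)
    (hab₁ : dist (a₁ : Plane) b₁ ≤ ρ) (hab₂ : dist (a₂ : Plane) b₂ ≤ ρ)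
    {P : List V} (hP : P.Nodup) (hPo : ∀ v ∈ P, v ∈ obstruction η V r o)
    (hPc : P.IsChain fun v w : V => dist (v : Plane) w ≤ ρ)
    (hP₁ : P.head? = some a₁) (hP₂ : P.getLast? = some a₂)
    (hcard : ∀ q : densePoints η V r, {v | v ∈ P ∧ corner η r v = q}.ncard ≤ 4) :
    ∃ T : List V, (P ++ T).Nodup ∧
      (∀ v ∈ P ++ T, dist (v : Plane) ((P ++ T).formPerm v) ≤ ρ) ∧
      (∀ v ∈ P ++ T, dist o v < 200 * r) ∧
      (∀ q : densePoints η V r, {v | v ∈ P ++ T ∧ corner η r v = q}.ncard ≤ 7) ∧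
      ∃ q₁ : densePoints η V r, ¬ IsSmall q₁ ∧ ∃ z ∈ P ++ T, corner η r z = q₁ ∧
        ∀ w : V, corner η r w = q₁ → dist (w : Plane) ((P ++ T).formPerm z) ≤ ρ := by
  have hVfin : Finite V := h.finite
  have hr := h.r_pos
  have hr' := h.rPrime_lt
  have hpos := h.rPrime_pos
  have hρ := h.rho_le
  have hng₁ := h.nearGiant_of_adj ha₁ hb₁ hab₁
  have hng₂ := h.nearGiant_of_adj ha₂ hb₂ hab₂
  obtain ⟨q₁, hq₁, hd₁⟩ := hng₁
  obtain ⟨q₂, hq₂, hd₂⟩ := hng₂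
  have hnear : ∀ v ∈ obstruction η V r o, dist o v < 3 * r := fun v hv => by
    have := (h.rep_corner_mem hv.1).2
    rwa [hv.2] at this
  have hob₁ : dist o b₁ < 5 * r := by
    have := dist_triangle o a₁ b₁
    have := hnear a₁ ha₁
    linarith
  have hob₂ : dist o b₂ < 5 * r := by
    have := dist_triangle o a₂ b₂
    have := hnear a₂ ha₂
    linarith
  have hoq : ∀ (b : V) (q : densePoints η V r), dist o b < 5 * r →
      dist (q : Plane) (corner η r b) ≤ rPrime η r → dist o q < 7 * r := fun b q h1 h2 => by
    have h3 := h.dist_corner_lt b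
    rw [dist_comm] at h2
    have := dist_triangle4 o b (corner η r b) q
    linarith
  have hoq₁ := hoq b₁ q₁ hob₁ hd₁
  have hoq₂ := hoq b₂ q₂ hob₂ hd₂
  -- Both ends are within `7 r` of `o`. The path starts at `q₂` since the ear leaves `P` at `a₂` and
  -- returns to `a₁`.
  obtain ⟨p, hp, hball⟩ := h.p5 q₂ q₁ (by
    have := dist_triangle_left (q₂ : Plane) q₁ o
    linarith) hq₂ hq₁
  have hbs : ({b₁, b₂} : Set V).ncard < 100 := by
    rw [Set.ncard_pair hb]; norm_num
  -- The ear takes one vertex from each cell of the path; `b₁` and `b₂` may lie in such cells and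
  -- are avoided.
  choose f hf hfb using fun q => h.exists_corner_notMem q {b₁, b₂} hbs
  have hfinj : Injective f := fun q q' hq => Subtype.ext (by rw [← hf q, ← hf q', hq])
  have hfb₁ : ∀ q, f q ≠ b₁ := fun q hq => hfb q (by simp [hq])
  have hfb₂ : ∀ q, f q ≠ b₂ := fun q hq => hfb q (by simp [hq])
  obtain ⟨S, hS⟩ : ∃ S, p.support = S ++ [q₁] :=
    ⟨p.support.dropLast, by
      conv_lhs => rw [← List.dropLast_append_getLast p.support_ne_nil, p.getLast_support]⟩
  have hnotsmall : ∀ q ∈ p.support, ¬ IsSmall q := fun q hq => by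
    rw [isSmall_congr (p.takeUntil q hq).reachable.symm]
    exact hq₂
  set X := p.support.map f with hX
  have hXn : X.Nodup := hp.support_nodup.map hfinj
  have hXmem : ∀ v ∈ X, ∃ q ∈ p.support, f q = v := fun v hv => by simpa [hX] using hv
  have hXng : ∀ v ∈ X, v ∉ obstruction η V r o := fun v hv hvo => by
    obtain ⟨q, hq, rfl⟩ := hXmem v hv
    exact hvo.1 (h.nearGiant_of_corner_eq (hnotsmall q hq) (hf q))
  have hXb₁ : b₁ ∉ X := fun hv => by
    obtain ⟨q, -, hq⟩ := hXmem _ hv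
    exact hfb₁ q hq
  have hXb₂ : b₂ ∉ X := fun hv => by
    obtain ⟨q, -, hq⟩ := hXmem _ hv
    exact hfb₂ q hq
  have hXS : X = S.map f ++ [f q₁] := by simp [hX, hS]
  have hXc : X.IsChain fun v w : V => dist (v : Plane) w ≤ ρ := by
    rw [hX, List.isChain_map]
    refine p.isChain_adj_support.imp fun q q' hqq' => h.dist_le_rho_of_corner ?_
    rw [hf, hf]
    exact hqq'.2
  have hXhead : X.head? = some (f q₂) := by
    rw [hX, ← p.cons_tail_support, List.map_cons, List.head?_cons]
  have hXlast : X.getLast? = some (f q₁) := by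
    rw [hXS]; simp
  have hnod : (P ++ b₂ :: (X ++ [b₁])).Nodup := by
    rw [List.nodup_append']
    refine ⟨hP, ?_, ?_⟩
    · rw [List.nodup_cons]
      refine ⟨by simp [hXb₂, hb.symm], ?_⟩
      rw [List.nodup_append']
      refine ⟨hXn, by simp, by simpa using hXb₁⟩
    · intro v hv hv'
      have hvo := hPo v hv
      simp only [List.mem_cons, List.mem_append, List.not_mem_nil, or_false] at hv'
      rcases hv' with rfl | hv' | rfl
      · exact hb₂ hvo
      · exact hXng v hv' hvo
      · exact hb₁ hvo
  refine ⟨b₂ :: (X ++ [b₁]), hnod, ?_, ?_, ?_, q₁, hq₁, f q₁, ?_, hf q₁, ?_⟩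
  · obtain ⟨P', rfl⟩ : ∃ P', P = a₁ :: P' := by
      cases P with
      | nil => simp at hP₁
      | cons x P' => exact ⟨P', by simpa using hP₁⟩
    intro v hv
    refine rel_formPerm (R := fun v w : V => dist (v : Plane) w ≤ ρ) hnod ?_ hv
    change List.IsChain _ ((a₁ :: P' ++ b₂ :: (X ++ [b₁])) ++ [a₁])
    rw [List.isChain_append]
    refine ⟨?_, by simp, ?_⟩
    · rw [List.isChain_append]
      refine ⟨hPc, ?_, ?_⟩
      · rw [List.isChain_cons]
        refine ⟨?_, ?_⟩
        · intro y hy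
          have hy : y = f q₂ := by
            rw [List.head?_append, hXhead] at hy
            simpa using hy.symm
          rw [hy]
          refine h.dist_le_rho_of_corner ?_
          rw [hf, dist_comm]
          exact hd₂
        · rw [List.isChain_append]
          refine ⟨hXc, by simp, ?_⟩
          intro x hx y hy
          rw [hXlast] at hx
          obtain rfl : f q₁ = x := by simpa using hx
          obtain rfl : b₁ = y := by simpa using hy
          refine h.dist_le_rho_of_corner ?_
          rw [hf]
          exact hd₁
      · intro x hx y hy
        rw [hP₂] at hx
        obtain rfl : a₂ = x := by simpa using hx
        obtain rfl : b₂ = y := by simpa using hy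
        exact hab₂
    · intro x hx y hy
      obtain rfl : b₁ = x := by
        have : a₁ :: P' ++ b₂ :: (X ++ [b₁]) = (a₁ :: P' ++ b₂ :: X) ++ [b₁] := by simp
        rw [this, List.getLast?_concat] at hx
        simpa using hx
      obtain rfl : a₁ = y := by simpa using hy
      rw [dist_comm]
      exact hab₁
  · intro v hv
    simp only [List.mem_append, List.mem_cons, List.not_mem_nil, or_false] at hv
    rcases hv with hv | rfl | hv | rfl
    · exact (hnear v (hPo v hv)).trans (by linarith)
    · linarith
    · obtain ⟨q, hq, rfl⟩ := hXmem v hv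
      have h1 := hball q hq
      rw [Metric.mem_closedBall, dist_comm] at h1
      have h2 := h.dist_corner_lt (f q)
      rw [hf, dist_comm] at h2
      have := dist_triangle4 o q₂ q (f q)
      linarith
    · linarith
  · intro q
    have hsub : {v | v ∈ P ++ b₂ :: (X ++ [b₁]) ∧ corner η r v = q} ⊆
        {v | v ∈ P ∧ corner η r v = q} ∪ {b₁, b₂, f q} := by
      rintro v ⟨hv, hvq⟩
      simp only [List.mem_append, List.mem_cons, List.not_mem_nil, or_false] at hv
      rcases hv with hv | rfl | hv | rfl
      · exact Or.inl ⟨hv, hvq⟩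
      · simp
      · obtain ⟨q', hq', rfl⟩ := hXmem v hv
        rw [hf] at hvq
        obtain rfl : q' = q := Subtype.ext hvq
        simp
      · simp
    refine (Set.ncard_le_ncard hsub (Set.toFinite _)).trans ((Set.ncard_union_le _ _).trans ?_)
    have h1 := hcard q
    have h2 : ({b₁, b₂, f q} : Set V).ncard ≤ 3 := by
      have h3 := Set.ncard_insert_le b₁ {b₂, f q}
      have h4 := Set.ncard_insert_le b₂ {f q}
      rw [Set.ncard_singleton] at h4
      omega
    omega
  · rw [hXS]; simp
  -- The successor of `f q₁` on the ear is `b₁`, which is close to every vertex of the cell of `q₁`;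
  -- this is where the giant can be merged in.
  · intro w hw
    have hE : P ++ b₂ :: (X ++ [b₁]) = (P ++ b₂ :: S.map f) ++ f q₁ :: b₁ :: [] := by
      rw [hXS]; simp
    rw [hE] at hnod ⊢
    rw [formPerm_append_cons_cons hnod]
    refine h.dist_le_rho_of_corner ?_
    rw [hw]
    exact hd₁

end IsConfig

end RGG

namespace RGG

open Equiv Function

namespace IsConfig

variable {η r ρ : ℝ} {V : Set Plane}

theorem dist_le_of_bad (h : IsConfig η r ρ V) {o : Plane} {v w : V}
    (hv : v ∈ obstruction η V r o) (hw : w ∈ obstruction η V r o)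
    (hvb : corner η r v ∈ badPoints η V r) (hwb : corner η r w ∈ badPoints η V r) :
    dist (v : Plane) w ≤ ρ :=
  h.dist_le_rho_of_corner
    (h.dist_lt_of_rep_eq (Or.inr hvb) (Or.inr hwb) (hv.2.trans hw.2.symm)).le

theorem not_bad_of_small (h : IsConfig η r ρ V) {c : densePoints η V r} (hc : IsSmall c) {v : V}
    (hv : v ∈ obstruction η V r (rep η V r c)) : corner η r v ∉ badPoints η V r := fun hb => by
  have h1 := h.dist_lt_of_rep_eq (Or.inl ⟨c, hc, rfl⟩) (Or.inr hb) hv.2.symm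
  have h2 := h.lt_dist_bad hc hb
  have := h.rPrime_lt
  have := h.r_pos
  linarith

theorem exists_crossing_edges (h : IsConfig η r ρ V) {o : Plane}
    (ho : (obstruction η V r o).Nonempty) :
    ∃ a₁ a₂ b₁ b₂ : V, a₁ ∈ obstruction η V r o ∧ a₂ ∈ obstruction η V r o ∧
      b₁ ∉ obstruction η V r o ∧ b₂ ∉ obstruction η V r o ∧ b₁ ≠ b₂ ∧
      dist (a₁ : Plane) b₁ ≤ ρ ∧ dist (a₂ : Plane) b₂ ≤ ρ ∧
      (a₁ ≠ a₂ ∨ obstruction η V r o = {a₁}) := by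
  obtain ⟨q, hq⟩ := h.exists_not_isSmall
  obtain ⟨c, hc, -⟩ := h.exists_corner_notMem q ∅ (by simp)
  obtain ⟨d, hd, hdc⟩ := h.exists_corner_notMem q {c} (by simp)
  obtain ⟨a₁, a₂, b₁, b₂, ha₁, ha₂, hb₁, hb₂, hb, hab₁, hab₂, hne⟩ :=
    h.conn.exists_crossing_edges ho (fun hco => hco.1 (h.nearGiant_of_corner_eq hq hc))
      (fun hdo => hdo.1 (h.nearGiant_of_corner_eq hq hd)) (fun e => hdc e.symm)
  exact ⟨a₁, a₂, b₁, b₂, ha₁, ha₂, hb₁, hb₂, hb, hab₁.2, hab₂.2, hne⟩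

/-- Every obstruction meets a cycle through the giant, which contains the whole obstruction or has
two consecutive vertices in one of its small components. -/
theorem exists_ear [DecidableEq V] (h : IsConfig η r ρ V) {o : Plane}
    (ho : (obstruction η V r o).Nonempty) :
    ∃ E : List V, E.Nodup ∧ (∀ v ∈ E, dist (v : Plane) (E.formPerm v) ≤ ρ) ∧
      (∀ v ∈ E, dist o v < 200 * r) ∧
      (∀ q : densePoints η V r, {v | v ∈ E ∧ corner η r v = q}.ncard ≤ 7) ∧
      (∃ q₁ : densePoints η V r, ¬ IsSmall q₁ ∧ ∃ z ∈ E, corner η r z = q₁ ∧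
        ∀ w : V, corner η r w = q₁ → dist (w : Plane) (E.formPerm z) ≤ ρ) ∧
      ((∀ v ∈ obstruction η V r o, v ∈ E) ∨
        ∃ c : densePoints η V r, IsSmall c ∧ rep η V r c = o ∧ ∃ y ∈ E, corner η r y = c ∧
          ∀ w : V, corner η r w = c → dist (w : Plane) (E.formPerm y) ≤ ρ) := by
  have hVfin : Finite V := h.finite
  have hρ : 0 ≤ ρ := h.r_pos.le.trans h.le_rho
  obtain ⟨a₁, a₂, b₁, b₂, ha₁, ha₂, hb₁, hb₂, hb, hab₁, hab₂, hne⟩ := h.exists_crossing_edges ho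
  by_cases hsmall : ∃ c : densePoints η V r, IsSmall c ∧ rep η V r c = o
  · obtain ⟨c, hc, rfl⟩ := hsmall
    have hattach : ∀ a ∈ obstruction η V r (rep η V r c), ∃ c' : densePoints η V r,
        IsSmall c' ∧ dist (c' : Plane) (corner η r a) ≤ rPrime η r ∧
          rep η V r c' = rep η V r c := fun a ha => by
      obtain ⟨c', hc', hd⟩ := (h.exists_obstructionPoint ha.1).resolve_left
        (h.not_bad_of_small hc ha)
      exact ⟨c', hc', hd, (h.rep_corner_eq (Or.inl ⟨c', hc', rfl⟩) hd).symm.trans ha.2⟩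
    obtain ⟨c₁, hc₁, hd₁, hr₁⟩ := hattach a₁ ha₁
    obtain ⟨c₂, hc₂, hd₂, hr₂⟩ := hattach a₂ ha₂
    -- The cells of `c₁` and `c₂` may coincide, so `y₂` must avoid `y₁` too. The arc from `y₁` to
    -- `y₂` is where the small component is merged in later.
    obtain ⟨y₁, hy₁, hya₁⟩ := h.exists_corner_notMem c₁ {a₁, a₂}
      ((Set.ncard_insert_le _ _).trans_lt (by simp))
    obtain ⟨y₂, hy₂, hya₂⟩ := h.exists_corner_notMem c₂ {a₁, a₂, y₁}
      ((Set.ncard_insert_le _ _).trans_lt (by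
        have := Set.ncard_insert_le a₂ {y₁}
        rw [Set.ncard_singleton] at this
        omega))
    simp only [Set.mem_insert_iff, Set.mem_singleton_iff, not_or] at hya₁ hya₂
    have hy₁o : y₁ ∈ obstruction η V r (rep η V r c) := hr₁ ▸ mem_obstruction_of_corner_eq hc₁ hy₁
    have hy₂o : y₂ ∈ obstruction η V r (rep η V r c) := hr₂ ▸ mem_obstruction_of_corner_eq hc₂ hy₂
    -- `y₁` is an element of the obstruction other than `a₁`.
    have hane : a₁ ≠ a₂ := hne.resolve_right fun hs => hya₁.1 (by rw [hs] at hy₁o; exact hy₁o)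
    have hc₁₂ : dist (c₁ : Plane) c₂ ≤ rPrime η r := (h.dist_lt_of_rep_eq (Or.inl ⟨c₁, hc₁, rfl⟩)
      (Or.inl ⟨c₂, hc₂, rfl⟩) (hr₁.trans hr₂.symm)).le
    obtain ⟨T, hn, hT, hdist, hcard, hq⟩ := h.exists_ear_of_path ha₁ ha₂ hb₁ hb₂ hb hab₁ hab₂
      (P := [a₁, y₁, y₂, a₂])
      (by
        simp only [List.nodup_cons, List.mem_cons, List.not_mem_nil, or_false, not_or,
          List.nodup_nil, not_false_eq_true, and_true]
        exact ⟨⟨Ne.symm hya₁.1, Ne.symm hya₂.1, hane⟩, ⟨Ne.symm hya₂.2.2, hya₁.2⟩, hya₂.2.1⟩)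
      (by simp [ha₁, ha₂, hy₁o, hy₂o])
      (by
        simp only [List.isChain_cons_cons, List.isChain_singleton, and_true]
        refine ⟨h.dist_le_rho_of_corner ?_, h.dist_le_rho_of_corner ?_,
          h.dist_le_rho_of_corner ?_⟩
        · rwa [hy₁, dist_comm]
        · rwa [hy₁, hy₂]
        · rwa [hy₂])
      (by simp) (by simp)
      (fun q => by
        refine (Set.ncard_le_ncard (t := {a₁, y₁, y₂, a₂}) ?_ (Set.toFinite _)).trans ?_
        · rintro v ⟨hv, -⟩
          simpa using hv
        · have h1 := Set.ncard_insert_le a₁ {y₁, y₂, a₂}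
          have h2 := Set.ncard_insert_le y₁ {y₂, a₂}
          have h3 := Set.ncard_insert_le y₂ {a₂}
          rw [Set.ncard_singleton] at h3
          omega)
    refine ⟨_, hn, hT, hdist, hcard, hq, Or.inr ⟨c₁, hc₁, hr₁, y₁, by simp, hy₁, ?_⟩⟩
    intro w hw
    have hE : [a₁, y₁, y₂, a₂] ++ T = [a₁] ++ y₁ :: y₂ :: (a₂ :: T) := rfl
    rw [hE] at hn ⊢
    rw [formPerm_append_cons_cons hn]
    refine h.dist_le_rho_of_corner ?_
    rwa [hw, hy₂]
  -- Without small points in the cluster all corners are bad, hence within `r'` of each other. Any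
  -- enumeration of the obstruction from `a₁` to `a₂` is then a path.
  · have hbad : ∀ v ∈ obstruction η V r o, corner η r v ∈ badPoints η V r := fun v hv => by
      refine (h.exists_obstructionPoint hv.1).resolve_right ?_
      rintro ⟨c, hc, hd⟩
      exact hsmall ⟨c, hc, (h.rep_corner_eq (Or.inl ⟨c, hc, rfl⟩) hd).symm.trans hv.2⟩
    have hclique : ∀ v ∈ obstruction η V r o, ∀ w ∈ obstruction η V r o,
        dist (v : Plane) w ≤ ρ := fun v hv w hw => h.dist_le_of_bad hv hw (hbad v hv) (hbad w hw)
    obtain ⟨P, hP, hPo, hP₁, hP₂⟩ : ∃ P : List V, P.Nodup ∧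
        (∀ v, v ∈ P ↔ v ∈ obstruction η V r o) ∧ P.head? = some a₁ ∧ P.getLast? = some a₂ := by
      by_cases hane : a₁ = a₂
      · refine ⟨[a₁], by simp, fun v => ?_, by simp, by simp [hane]⟩
        rw [hne.resolve_left (not_not.2 hane)]
        simp
      · refine ⟨a₁ :: ((Set.toFinite (obstruction η V r o \ {a₁, a₂})).toFinset.toList ++ [a₂]),
          ?_, fun v => ?_, by simp, ?_⟩
        · rw [List.nodup_cons, List.nodup_append']
          refine ⟨by simp [hane], Finset.nodup_toList _, by simp, ?_⟩
          intro v hv hv'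
          simp only [List.mem_singleton] at hv'
          simp [hv'] at hv
        · simp only [List.mem_cons, List.mem_append, Finset.mem_toList, Set.Finite.mem_toFinset,
            Set.mem_sdiff, Set.mem_insert_iff, Set.mem_singleton_iff, List.not_mem_nil, or_false]
          constructor
          · rintro (rfl | hv | rfl)
            · exact ha₁
            · exact hv.1
            · exact ha₂
          · intro hv
            tauto
        · rw [← List.cons_append, List.getLast?_concat]
    have hPc : P.IsChain fun v w : V => dist (v : Plane) w ≤ ρ :=
      (List.pairwise_of_forall_mem_list fun v hv w hw =>
        hclique v ((hPo v).1 hv) w ((hPo w).1 hw)).isChain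
    obtain ⟨T, hn, hT, hdist, hcard, hq⟩ := h.exists_ear_of_path ha₁ ha₂ hb₁ hb₂ hb hab₁ hab₂
      hP (fun v hv => (hPo v).1 hv) hPc hP₁ hP₂ (fun q => by
        have : {v | v ∈ P ∧ corner η r v = q} = ∅ := by
          ext v
          simp only [Set.mem_ofPred_eq, Set.mem_empty_iff_false, iff_false, not_and]
          intro hv hvq
          have hb := hbad v ((hPo v).1 hv)
          rw [hvq] at hb
          exact hb.2 q q.2.1 (by simpa using h.rPrime_pos.le) q.2
        rw [this]; simp)
    exact ⟨_, hn, hT, hdist, hcard, hq, Or.inl fun v hv => by simp [(hPo v).2 hv]⟩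

end IsConfig

end RGG

/-! ### Reserved vertices and the initial permutation. -/

namespace RGG

open Equiv Function

namespace IsConfig

variable {η r ρ : ℝ} {V : Set Plane}

/-- Every dense cell has enough vertices outside a family of cycles that are far apart. -/
theorem exists_slots {ι : Type*} (h : IsConfig η r ρ V) (E : ι → List V)
    (hsep : ∀ i j v w, v ∈ E i → w ∈ E j → dist (v : Plane) w ≤ ρ → i = j)
    (hcard : ∀ i (q : densePoints η V r), {v | v ∈ E i ∧ corner η r v = q}.ncard ≤ 7) :
    ∃ s : densePoints η V r × Slot → V, Injective s ∧
      ∀ q t, corner η r (s (q, t)) = q ∧ ∀ i, s (q, t) ∉ E i := by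
  have hVfin : Finite V := h.finite
  have hq : ∀ q : densePoints η V r, ∃ g : Slot → V, Injective g ∧
      ∀ t, corner η r (g t) = q ∧ ∀ i, g t ∉ E i := by
    intro q
    -- Vertices of one cell are close, so only one cycle of the family can meet it.
    have hear : {v | (∃ i, v ∈ E i) ∧ corner η r v = q}.ncard ≤ 7 := by
      by_cases hne : ∃ i v, v ∈ E i ∧ corner η r v = q
      · obtain ⟨i, v, hv, hvq⟩ := hne
        refine (Set.ncard_le_ncard ?_ (Set.toFinite _)).trans (hcard i q)
        rintro w ⟨⟨j, hw⟩, hwq⟩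
        obtain rfl : j = i := hsep j i w v hw hv
          (h.dist_le_rho_of_corner (by rw [hwq, hvq]; simpa using h.rPrime_pos.le))
        exact ⟨hw, hwq⟩
      · have : {v | (∃ i, v ∈ E i) ∧ corner η r v = q} = ∅ := by
          ext v
          simp only [Set.mem_ofPred_eq, Set.mem_empty_iff_false, iff_false]
          rintro ⟨⟨i, hv⟩, hvq⟩
          exact hne ⟨i, v, hv, hvq⟩
        rw [this]; simp
    have hsub : {v : V | corner η r v = q} ⊆
        {v | (∃ i, v ∈ E i) ∧ corner η r v = q} ∪ {v | corner η r v = q ∧ ∀ i, v ∉ E i} := by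
      intro v hv
      by_cases hi : ∃ i, v ∈ E i
      · exact Or.inl ⟨hi, hv⟩
      · exact Or.inr ⟨hv, not_exists.1 hi⟩
    have h1 := h.hundred_le_ncard q
    have h2 := (Set.ncard_le_ncard hsub (Set.toFinite _)).trans (Set.ncard_union_le _ _)
    have h3 : Fintype.card Slot ≤ {v : V | corner η r v = q ∧ ∀ i, v ∉ E i}.ncard := by
      rw [card_slot]; omega
    cases nonempty_fintype {v : V | corner η r v = q ∧ ∀ i, v ∉ E i}
    rw [← Nat.card_coe_set_eq, Nat.card_eq_fintype_card] at h3
    obtain ⟨g⟩ := Function.Embedding.nonempty_of_card_le h3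
    exact ⟨fun t => g t, Subtype.val_injective.comp g.injective, fun t => (g t).2⟩
  choose g hg hg' using hq
  refine ⟨fun p => g p.1 p.2, ?_, fun q t => hg' q t⟩
  rintro ⟨q, t⟩ ⟨q', t'⟩ he
  obtain rfl : q = q' := Subtype.ext (by
    rw [← (hg' q t).1, ← (hg' q' t').1]
    exact congrArg (fun v : V => corner η r v) he)
  rw [show t = t' from hg q he]

theorem exists_attach (h : IsConfig η r ρ V) (v : V) : ∃ q : densePoints η V r,
    (corner η r v ∉ badPoints η V r → dist (q : Plane) (corner η r v) ≤ rPrime η r) ∧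
      ∀ q' : densePoints η V r, corner η r v = q' → q = q' := by
  by_cases hd : corner η r v ∈ densePoints η V r
  · refine ⟨⟨_, hd⟩, fun _ => ?_, fun q' hq' => Subtype.ext hq'⟩
    simpa using h.rPrime_pos.le
  · rcases h.bad_or_exists_dense v with hb | ⟨q, hq⟩
    -- An arbitrary value: vertices with a bad corner will all lie on ears.
    · obtain ⟨q, -⟩ := h.exists_not_isSmall
      exact ⟨q, fun hb' => absurd hb hb', fun q' hq' => absurd (hq' ▸ q'.2) hd⟩
    · exact ⟨q, fun _ => hq, fun q' hq' => absurd (hq' ▸ q'.2) hd⟩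

/-- A permutation whose orbits are given disjoint cycles, the remaining parts of the dense cells,
and cliques of the remaining vertices. -/
theorem exists_initial_perm [DecidableEq V] {ι : Type*} (h : IsConfig η r ρ V) (E : ι → List V)
    (hsep : ∀ i j v w, v ∈ E i → w ∈ E j → dist (v : Plane) w ≤ ρ → i = j)
    (hn : ∀ i, (E i).Nodup) (hrel : ∀ i, ∀ v ∈ E i, dist (v : Plane) ((E i).formPerm v) ≤ ρ)
    (att : V → densePoints η V r) (hatt : ∀ (v : V) (q : densePoints η V r), corner η r v = q → att v = q) :
    ∃ σ : Perm V, (∀ v : V, dist (v : Plane) (σ v) ≤ ρ) ∧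
      (∀ i, ∀ v ∈ E i, σ v = (E i).formPerm v) ∧
      (∀ i v w, v ∈ E i → w ∈ E i → σ.SameCycle v w) ∧
      (∀ (q : Plane) (v w : V), corner η r v = q → (∀ i, v ∉ E i) → corner η r w = q → (∀ i, w ∉ E i) →
        q ∈ densePoints η V r → σ.SameCycle v w) ∧
      (∀ v w : V, (∀ i, v ∉ E i) → (∀ i, w ∉ E i) → corner η r v ∉ densePoints η V r →
        corner η r w ∉ densePoints η V r → att v = att w →
        squareIndex (rPrime η r) (corner η r v) = squareIndex (rPrime η r) (corner η r w) →
        σ.SameCycle v w) ∧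
      ∀ v : V, (∀ i, v ∉ E i) → (∀ i, σ v ∉ E i) ∧ att (σ v) = att v ∧
        (corner η r v ∈ densePoints η V r → corner η r (σ v) = corner η r v) := by
  classical
  have hVfin : Finite V := h.finite
  have hρ : 0 ≤ ρ := h.r_pos.le.trans h.le_rho
  have huniq : ∀ i j v, v ∈ E i → v ∈ E j → i = j := fun i j v hi hj =>
    hsep i j v v hi hj (by simpa using hρ)
  -- The labels of the future orbits. Off the cycles, vertices with equal labels have corners in one
  -- square, so any cyclic order on such a class moves its vertices by at most `ρ`.
  let β : V → ι ⊕ (densePoints η V r ⊕ densePoints η V r × (ℤ × ℤ)) := fun v =>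
    if hv : ∃ i, v ∈ E i then .inl hv.choose
    else if corner η r v ∈ densePoints η V r then .inr (.inl (att v))
    else .inr (.inr (att v, squareIndex (rPrime η r) (corner η r v)))
  have hβE : ∀ i v, v ∈ E i → β v = .inl i := fun i v hv => by
    have hex : ∃ i, v ∈ E i := ⟨i, hv⟩
    simp only [β, dif_pos hex]
    rw [huniq _ _ v hex.choose_spec hv]
  have hβE' : ∀ i v, β v = .inl i → v ∈ E i := fun i v hv => by
    by_cases hex : ∃ i, v ∈ E i
    · obtain ⟨j, hj⟩ := hex
      rw [hβE j v hj] at hv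
      rwa [← Sum.inl_injective hv]
    · simp only [β, dif_neg hex] at hv
      split_ifs at hv
  have hβF : ∀ v : V, (∀ i, v ∉ E i) → corner η r v ∈ densePoints η V r →
      β v = .inr (.inl (att v)) := fun v hv hd => by
    simp only [β, dif_neg (not_exists.2 hv), if_pos hd]
  have hβT : ∀ v : V, (∀ i, v ∉ E i) → corner η r v ∉ densePoints η V r →
      β v = .inr (.inr (att v, squareIndex (rPrime η r) (corner η r v))) := fun v hv hd => by
    simp only [β, dif_neg (not_exists.2 hv), if_neg hd]
  have hτ : ∀ l, ∃ τ : Perm V, τ.IsCycleOn {v | β v = l} ∧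
      ∀ i, l = .inl i → τ = (E i).formPerm := by
    rintro (i | l)
    · refine ⟨(E i).formPerm, ?_, fun j hj => by rw [Sum.inl_injective hj]⟩
      have : {v | β v = .inl i} = {v | v ∈ E i} := by
        ext v; exact ⟨hβE' i v, hβE i v⟩
      rw [this]
      exact (hn i).isCycleOn_formPerm
    · obtain ⟨τ, hτ⟩ := exists_isCycleOn {v | β v = .inr l}
      exact ⟨τ, hτ, fun i hi => absurd hi (by simp)⟩
  choose τ hτ hτE using hτ
  obtain ⟨σ, hσ, hsame⟩ := exists_perm_glue β τ hτ
  have hβσ : ∀ v, β (σ v) = β v := fun v => by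
    rw [hσ]; exact (hτ (β v)).apply_mem_iff.2 rfl
  have hσE : ∀ i, ∀ v ∈ E i, σ v = (E i).formPerm v := fun i v hv => by
    rw [hσ, hτE _ i (hβE i v hv)]
  have hdense : ∀ v : V, corner η r v ∈ densePoints η V r → corner η r v = att v := fun v hd => by
    rw [hatt v ⟨_, hd⟩ rfl]
  have hout : ∀ v, (∀ i, v ∉ E i) → ∀ i, σ v ∉ E i := fun v hv i hi => by
    have := hβE i _ hi
    rw [hβσ] at this
    exact hv i (hβE' i v this)
  have hstep : ∀ v : V, (∀ i, v ∉ E i) → att (σ v) = att v ∧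
      (corner η r v ∈ densePoints η V r → corner η r (σ v) = corner η r v) ∧
      squareIndex (rPrime η r) (corner η r (σ v)) = squareIndex (rPrime η r) (corner η r v) := by
    intro v hv
    have hb := hβσ v
    by_cases hd : corner η r v ∈ densePoints η V r <;>
      by_cases hd' : corner η r (σ v) ∈ densePoints η V r
    · rw [hβF v hv hd, hβF _ (hout v hv) hd'] at hb
      have hb : att (σ v) = att v := Sum.inl_injective (Sum.inr_injective hb)
      have hc : corner η r (σ v) = corner η r v := by rw [hdense _ hd, hdense _ hd', hb]
      exact ⟨hb, fun _ => hc, by rw [hc]⟩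
    · rw [hβF v hv hd, hβT _ (hout v hv) hd'] at hb
      simp at hb
    · rw [hβT v hv hd, hβF _ (hout v hv) hd'] at hb
      simp at hb
    · rw [hβT v hv hd, hβT _ (hout v hv) hd'] at hb
      have hb := Prod.mk.inj (Sum.inr_injective (Sum.inr_injective hb))
      exact ⟨hb.1, fun hd'' => absurd hd'' hd, hb.2⟩
  refine ⟨σ, fun v => ?_, hσE, fun i v w hv hw => hsame v w (by rw [hβE i v hv, hβE i w hw]),
    ?_, ?_, fun v hv => ⟨hout v hv, (hstep v hv).1, (hstep v hv).2.1⟩⟩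
  · by_cases hex : ∃ i, v ∈ E i
    · obtain ⟨i, hi⟩ := hex
      rw [hσE i v hi]
      exact hrel i v hi
    · refine h.dist_le_rho_of_corner (dist_lt_of_squareIndex_eq h.rPrime_pos ?_).le
      exact (hstep v (not_exists.1 hex)).2.2.symm
  · intro q v w hv hvE hw hwE hq
    refine hsame v w ?_
    rw [hβF v hvE (hv ▸ hq), hβF w hwE (hw ▸ hq), hatt v ⟨q, hq⟩ hv, hatt w ⟨q, hq⟩ hw]
  · intro v w hvE hwE hv hw ha hs
    refine hsame v w ?_
    rw [hβT v hvE hv, hβT w hwE hw, ha, hs]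

end IsConfig

end RGG

/-! ### Assembling a single orbit. -/

namespace RGG

open Equiv Function

namespace IsConfig

variable {η r ρ : ℝ} {V : Set Plane}

/-- There is a permutation of the vertices with a single orbit that moves no vertex further than
`ρ`. -/
theorem exists_perm_sameCycle [DecidableEq V] (h : IsConfig η r ρ V) :
    ∃ σ : Perm V, (∀ v : V, dist (v : Plane) (σ v) ≤ ρ) ∧ ∀ v w, σ.SameCycle v w := by
  have hVfin : Finite V := h.finite
  have hDfin := h.finite_dense
  have hr := h.r_pos
  have hr' := h.rPrime_lt
  have hpos := h.rPrime_pos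
  have hρ := h.rho_le
  have hself : ∀ {v w : V} {p : Plane}, corner η r v = p → corner η r w = p →
      dist (v : Plane) w ≤ ρ := fun hv hw =>
    h.dist_le_rho_of_corner (by rw [hv, hw]; simpa using hpos.le)
  let O := Set.range fun v : {v : V // ¬ NearGiant η V r v} => rep η V r (corner η r v)
  have hO : ∀ o : O, (obstruction η V r o).Nonempty := fun ⟨_, v, rfl⟩ => ⟨v, v.2, rfl⟩
  have hmemO : ∀ {v : V} {o : Plane}, v ∈ obstruction η V r o → o ∈ O := fun {v o} hv =>
    ⟨⟨v, hv.1⟩, hv.2⟩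
  choose E hn hrel hdist hcard hgiant hrest using fun o : O => h.exists_ear (hO o)
  choose g hg z hz hzg hzrel using hgiant
  -- Representatives of different obstructions are more than `1000 r` apart, while two close ears
  -- would bring them within `200 r + 2 r + 200 r`.
  have hsep : ∀ (i j : O) (v w : V), v ∈ E i → w ∈ E j → dist (v : Plane) w ≤ ρ → i = j := by
    intro i j v w hv hw hd
    by_contra hij
    obtain ⟨a, ha⟩ := hO i
    obtain ⟨b, hb⟩ := hO j
    have h1 := h.lt_dist_rep_of_ne ha.1 hb.1 (by
      rw [ha.2, hb.2]
      exact fun e => hij (Subtype.ext e))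
    rw [ha.2, hb.2] at h1
    have := hdist i v hv
    have h2 := hdist j w hw
    rw [dist_comm] at h2
    have := dist_triangle4 (i : Plane) v w j
    linarith
  have hcell : ∀ (i j : O) (v w : V) (p : Plane), v ∈ E i → w ∈ E j → corner η r v = p →
      corner η r w = p → i = j := fun i j v w p hv hw hvp hwp =>
    hsep i j v w hv hw (hself hvp hwp)
  obtain ⟨s, hs, hslot⟩ := h.exists_slots E hsep hcard
  choose att hatt hatt' using h.exists_attach
  obtain ⟨σ, hσ, hσE, hσEE, hσF, hσT, hσout⟩ := h.exists_initial_perm E hsep hn hrel att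
    fun v q hq => hatt' v q hq
  have hinj : ∀ {q q' t t'}, s (q, t) = s (q', t') → q = q' ∧ t = t' := fun h =>
    Prod.mk.inj (hs h)
  have hslotc : ∀ q t, corner η r (s (q, t)) = q := fun q t => (hslot q t).1
  have hslotE : ∀ q t i, s (q, t) ∉ E i := fun q t => (hslot q t).2
  have hslotd : ∀ q t, corner η r (s (q, t)) ∈ densePoints η V r := fun q t => by
    rw [hslotc]; exact q.2
  have hσslot : ∀ q t, corner η r (σ (s (q, t))) = q := fun q t => by
    rw [(hσout _ (hslotE q t)).2.2 (hslotd q t), hslotc]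
  have hbadE : ∀ v : V, corner η r v ∈ badPoints η V r → ∃ i, v ∈ E i := by
    intro v hv
    have hng : ¬ NearGiant η V r v := fun ⟨q, _, hd⟩ => hv.2 q q.2.1 hd q.2
    have hvo : v ∈ obstruction η V r (rep η V r (corner η r v)) := ⟨hng, rfl⟩
    rcases hrest ⟨_, hmemO hvo⟩ with hall | ⟨c, hc, hco, -⟩
    · exact ⟨_, hall v hvo⟩
    · exact absurd hv (h.not_bad_of_small hc (by rw [hco]; exact hvo))
  -- merge the dense cells
  obtain ⟨σ₁, hm₁, hsame₁⟩ := exists_merges_cells (R := fun v w : V => dist (v : Plane) w ≤ ρ) hσ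
    (denseGraph η V r).Adj (fun _ _ hadj => hadj.symm) s hs
    (fun q q' t t' hqq' => h.dist_le_rho_of_corner (by
      rw [hslotc, hσslot]
      rcases hqq' with rfl | hadj
      · simpa using hpos.le
      · exact hadj.2))
    (fun q t t' => hσF q _ _ (hslotc q t) (hslotE q t) (hslotc q t') (hslotE q t') q.2)
    (fun q => squareIndex (rPrime η r) q)
    (fun q q' hqq' => eq_or_adj (dist_lt_of_squareIndex_eq hpos hqq').le)
    (fun q q' hadj => squareIndex_sub_mem_offsets hpos hadj.2)
  have hreach : ∀ {q q' : densePoints η V r} (t t' : Slot), (denseGraph η V r).Reachable q q' →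
      σ₁.SameCycle (s (q, t)) (s (q', t')) := by
    rintro q q' t t' ⟨p⟩
    induction p generalizing t with
    | nil =>
      exact hm₁.coarser _ _
        (hσF _ _ _ (hslotc _ t) (hslotE _ t) (hslotc _ t') (hslotE _ t') (Subtype.coe_prop _))
    | cons hadj p ih => exact (hsame₁ _ _ t t hadj).trans (ih t)
  -- merge the cliques of vertices attached to a dense cell
  let W := {v : V // (∀ i, v ∉ E i) ∧ corner η r v ∉ densePoints η V r}
  have hWatt : ∀ v : V, (∀ i, v ∉ E i) → dist (att v : Plane) (corner η r v) ≤ rPrime η r :=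
    fun v hv => hatt v fun hb => by
      obtain ⟨i, hi⟩ := hbadE v hb
      exact hv i hi
  let key : W → densePoints η V r × (ℤ × ℤ) := fun v =>
    (att v.1, squareIndex (rPrime η r) (corner η r v.1))
  let e : Set.range key → W := fun i => i.2.choose
  have he : ∀ i, key (e i) = i := fun i => i.2.choose_spec
  let off : W → offsets := fun v => ⟨squareIndex (rPrime η r) (corner η r v.1) -
    squareIndex (rPrime η r) (att v.1), squareIndex_sub_mem_offsets hpos (hWatt v.1 v.2.1)⟩
  have hneslot : ∀ (v : W) (q : densePoints η V r) t, s (q, t) ≠ v.1 := fun v q t hv =>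
    v.2.2 (hv ▸ hslotd q t)
  -- Cliques attached to one cell lie in different squares, so their offsets select different slots.
  obtain ⟨σ₂, hm₂, hsame₂⟩ := exists_merges_pairs
    (R := fun v w : V => dist (v : Plane) w ≤ ρ) hm₁.rel
    (fun i : Set.range key => s (att (e i).1, .inr (2, off (e i)))) (fun i => (e i).1)
    (by
      rintro (a | a) (b | b) hab <;> simp only [Sum.elim_inl, Sum.elim_inr] at hab
      · obtain ⟨h1, h2⟩ := hinj hab
        have h2 : (off (e a) : ℤ × ℤ) = off (e b) := by
          simpa using congrArg Subtype.val (Prod.mk.inj (Sum.inr_injective h2)).2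
        simp only [off, h1, sub_left_inj] at h2
        have : a = b := by
          apply Subtype.ext
          rw [← he a, ← he b]
          exact Prod.ext h1 h2
        rw [this]
      · exact absurd hab (hneslot _ _ _)
      · exact absurd hab.symm (hneslot _ _ _)
      · have : a = b := by
          apply Subtype.ext
          rw [← he a, ← he b, Subtype.ext hab]
        rw [this])
    (fun i => by
      have h1 : σ₁ (e i).1 = σ (e i).1 := hm₁.agree _ fun ⟨q, t, hv, _⟩ => hneslot _ q t hv.symm
      obtain ⟨h2, h3, -⟩ := hσout _ (e i).2.1
      rw [h1]
      refine h.dist_le_rho_of_corner ?_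
      rw [hslotc, ← h3]
      exact hWatt _ h2)
    (fun i => by
      have h1 : σ₁ (s (att (e i).1, .inr (2, off (e i)))) =
          σ (s (att (e i).1, .inr (2, off (e i)))) := hm₁.agree _ (by
        rintro ⟨q, t, hv, ht⟩
        obtain ⟨-, rfl⟩ := hinj hv
        simp at ht)
      rw [h1]
      refine h.dist_le_rho_of_corner ?_
      rw [hσslot, dist_comm]
      exact hWatt _ (e i).2.1)
  have hag₂ : ∀ v : V, (∃ i, v ∈ E i) → σ₂ v = σ v := by
    rintro v ⟨i, hi⟩
    refine (hm₁.trans hm₂).agree _ ?_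
    rintro (⟨q, t, rfl, -⟩ | (⟨j, rfl⟩ | ⟨j, rfl⟩))
    · exact hslotE _ _ _ hi
    · exact hslotE _ _ _ hi
    · exact (e j).2.1 _ hi
  have hag₂' : ∀ q (k : Fin 4), 2 ≤ k → σ₂ (s (q, .inl k)) = σ (s (q, .inl k)) := by
    intro q k hk
    refine (hm₁.trans hm₂).agree _ ?_
    rintro (⟨q', t, hv, ht⟩ | (⟨j, hv⟩ | ⟨j, hv⟩))
    · obtain ⟨-, rfl⟩ := hinj hv
      rcases ht with ht | ht | ⟨o, ht⟩ | ⟨o, ht⟩ <;> simp at ht <;> subst ht <;>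
        exact absurd hk (by decide)
    · exact absurd (hinj hv).2 (by simp)
    · exact hneslot _ _ _ hv.symm
  -- merge the ears with the giant
  have hginj : ∀ i j, g i = g j → i = j := fun i j hij =>
    hcell i j (z i) (z j) (g i) (hz i) (hz j) (hzg i) (by rw [hzg, hij])
  obtain ⟨σ₃, hm₃, hsame₃⟩ := exists_merges_pairs
    (R := fun v w : V => dist (v : Plane) w ≤ ρ) hm₂.rel
    (fun i : O => z i) (fun i => s (g i, .inl 2))
    (by
      rintro (a | a) (b | b) hab <;> simp only [Sum.elim_inl, Sum.elim_inr] at hab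
      · rw [hcell a b (z a) (z b) _ (hz a) (hz b) rfl (by rw [hab])]
      · exact absurd (hab ▸ hz a) (hslotE _ _ _)
      · exact absurd (hab ▸ hz b) (hslotE _ _ _)
      · rw [hginj a b (hinj hab).1])
    (fun i => by
      rw [hag₂' _ _ (by decide)]
      exact hself (hzg i) (hσslot _ _))
    (fun i => by
      rw [hag₂ _ ⟨i, hz i⟩, hσE i _ (hz i)]
      exact hzrel i _ (hslotc _ _))
  -- merge the ears with the small components
  let S := {i : O // ∃ c : densePoints η V r, IsSmall c ∧ rep η V r c = i ∧
    ∃ y ∈ E i, corner η r y = c ∧ ∀ w : V, corner η r w = c →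
      dist (w : Plane) ((E i).formPerm y) ≤ ρ}
  choose c hc hci y hy hyc hyrel using fun i : S => i.2
  have hyz : ∀ i j, y i ≠ z j := fun i j hij => hg j (by
    have : c i = g j := Subtype.ext (by rw [← hyc, hij, hzg])
    rw [← this]
    exact hc i)
  obtain ⟨σ₄, hm₄, hsame₄⟩ := exists_merges_pairs
    (R := fun v w : V => dist (v : Plane) w ≤ ρ) hm₃.rel
    (fun i : S => y i) (fun i => s (c i, .inl 3))
    (by
      rintro (a | a) (b | b) hab <;> simp only [Sum.elim_inl, Sum.elim_inr] at hab
      · rw [Subtype.ext (hcell a.1 b.1 (y a) (y b) _ (hy a) (hy b) rfl (by rw [hab]))]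
      · exact absurd (hab ▸ hy a) (hslotE _ _ _)
      · exact absurd (hab ▸ hy b) (hslotE _ _ _)
      · have hcab := (hinj hab).1
        have : (a.1 : Plane) = b.1 := by rw [← hci a, ← hci b, hcab]
        rw [Subtype.ext (Subtype.ext this)])
    (fun i => by
      have h1 : σ₃ (s (c i, .inl 3)) = σ₂ (s (c i, .inl 3)) := hm₃.agree _ (by
        rintro (⟨j, hv⟩ | ⟨j, hv⟩)
        · have hv : z j = s (c i, .inl 3) := hv
          exact hslotE _ _ _ (hv ▸ hz j)
        · exact absurd (hinj hv).2 (by simp))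
      rw [h1, hag₂' _ _ (by decide)]
      exact hself (hyc i) (hσslot _ _))
    (fun i => by
      have h1 : σ₃ (y i) = σ₂ (y i) := hm₃.agree _ (by
        rintro (⟨j, hv⟩ | ⟨j, hv⟩)
        · exact hyz i j hv.symm
        · exact hslotE _ _ _ (hv ▸ hy i))
      rw [h1, hag₂ _ ⟨_, hy i⟩, hσE _ _ (hy i)]
      exact hyrel i _ (hslotc _ _))
  have up₃ : ∀ {v w}, σ₃.SameCycle v w → σ₄.SameCycle v w := fun hvw => hm₄.coarser _ _ hvw
  have up₂ : ∀ {v w}, σ₂.SameCycle v w → σ₄.SameCycle v w := fun hvw => up₃ (hm₃.coarser _ _ hvw)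
  have up₁ : ∀ {v w}, σ₁.SameCycle v w → σ₄.SameCycle v w := fun hvw => up₂ (hm₂.coarser _ _ hvw)
  have up₀ : ∀ {v w}, σ.SameCycle v w → σ₄.SameCycle v w := fun hvw => up₁ (hm₁.coarser _ _ hvw)
  obtain ⟨q₀, hq₀⟩ := h.exists_not_isSmall
  set b := s (q₀, .inl 0) with hb
  have hear : ∀ i, ∀ v ∈ E i, σ₄.SameCycle v b := fun i v hv =>
    ((up₀ (hσEE i _ _ hv (hz i))).trans (up₃ (hsame₃ i))).trans
      (up₁ (hreach _ _ (h.reachable_of_not_isSmall (hg i) hq₀)))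
  have hdense : ∀ q t, σ₄.SameCycle (s (q, t)) b := by
    intro q t
    by_cases hq : IsSmall q
    -- Slots are off the ears, so the ear of this obstruction does not swallow it and meets some
    -- small cell `c i` of the same cluster. That cell is within `r'` of `q`, hence in the same
    -- component.
    · have hvo := mem_obstruction_of_corner_eq hq (hslotc q t)
      have hqO := hmemO hvo
      rcases hrest ⟨_, hqO⟩ with hall | hsm
      · exact absurd (hall _ hvo) (hslotE _ _ _)
      · let i : S := ⟨⟨_, hqO⟩, hsm⟩
        have hd : dist (q : Plane) (c i) < rPrime η r := h.dist_lt_of_rep_eq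
          (Or.inl ⟨q, hq, rfl⟩) (Or.inl ⟨c i, hc i, rfl⟩) (hci i).symm
        have hqc : (denseGraph η V r).Reachable q (c i) := by
          rcases eq_or_adj hd.le with hqc | hadj
          · rw [hqc]
          · exact hadj.reachable
        exact ((up₁ (hreach t (.inl 3) hqc)).trans (hsame₄ i).symm).trans (hear _ _ (hy i))
    · exact up₁ (hreach _ _ (h.reachable_of_not_isSmall hq hq₀))
  have hall : ∀ v, σ₄.SameCycle v b := by
    intro v
    by_cases hv : ∃ i, v ∈ E i
    · obtain ⟨i, hi⟩ := hv
      exact hear i v hi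
    have hv := not_exists.1 hv
    by_cases hd : corner η r v ∈ densePoints η V r
    · exact (up₀ (hσF _ v (s (⟨_, hd⟩, .inl 0)) rfl hv (hslotc _ _) (hslotE _ _) hd)).trans
        (hdense _ _)
    · let i : Set.range key := ⟨key ⟨v, hv, hd⟩, _, rfl⟩
      have hi := he i
      have h1 : att (e i).1 = att v := congrArg Prod.fst hi
      have h2 : squareIndex (rPrime η r) (corner η r (e i).1) =
          squareIndex (rPrime η r) (corner η r v) := congrArg Prod.snd hi
      exact ((up₀ (hσT v (e i).1 hv (e i).2.1 hd (e i).2.2 h1.symm h2.symm)).trans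
        (up₂ (hsame₂ i)).symm).trans (hdense _ _)
  exact ⟨σ₄, hm₄.rel, fun v w => (hall v).trans (hall w).symm⟩

end IsConfig

end RGG

theorem theorem6 (η r ρ : ℝ) (V : Set RGG.Plane) [Fintype V] [DecidableEq V]
    (hη₀ : 0 < η) (hη₁ : η < 1 / Real.sqrt 2) (hr : 0 < r)
    (hV : V ⊆ RGG.unitSquare)
    (hP1 : RGG.P1 η V r) (hP2 : RGG.P2 η V r) (hP3 : RGG.P3 η V r)
    (hP4 : RGG.P4 η V r) (hP5 : RGG.P5 η V r) (hP6 : RGG.P6 η V r)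
    (hρ₁ : r ≤ ρ) (hρ₂ : ρ ≤ 2 * r)
    (h2conn : RGG.IsKConnected (RGG.geomGraph V ρ) 2) :
    (RGG.geomGraph V ρ).IsHamiltonian := by
  have h : RGG.IsConfig η r ρ V :=
    ⟨hη₀, hη₁, hr, hV, Set.toFinite V, hP1, hP2, hP3, hP4, hP5, hP6, hρ₁, hρ₂, h2conn⟩
  have hcard : 3 ≤ Fintype.card V := by
    have := h2conn.1
    rw [ENat.card_eq_coe_fintype_card] at this
    exact_mod_cast this
  obtain ⟨σ, hσ, hcyc⟩ := h.exists_perm_sameCycle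
  exact RGG.isHamiltonian_of_sameCycle _ σ hcard hcyc fun v hv => ⟨hv, hσ v⟩
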